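/- Let $E=(E^0,E^1,s,r)$ be a finite directed graph and $K$ a field, and let $L_K(E)$ be the Leavitt path algebra of $E$: the unital $K$-algebra generated by $\{v : v\in E^0\}\cup\{e,e^* : e\in E^1\}$ with relations $vu=\delta_{v,u}v$, $s(e)e=er(e)=e$, $r(e)e^*=e^*s(e)=e^*$, $e^*e'=\delta_{e,e'}r(e)$, $v=\sum_{s(e)=v}ee^*$ for every vertex $v$ that is the source of some edge, and $1=\sum_{v\in E^0}v$. All modules are left modules. A closed path is a sequence of edges $c=e_1\cdots e_n$, $n\ge 1$, with $r(e_i)=s(e_{i+1})$ for $1\le i<n$ and $r(e_n)=s(e_1)$; it is basic if $c\ne d^k$ for every closed path $d$ and every integer $k\ge 2$. Two infinite paths $p=e_1e_2\cdots$ and $q=f_1f_2\cdots$ (where $r(e_i)=s(e_{i+1})$ and $r(f_i)=s(f_{i+1})$ for all $i$) are tail equivalent if they coincide after deleting some finite number $m$ of initial edges from $p$ and some finite number $n$ of initial edges from $q$. For an infinite path $p$, the Chen simple module $V_{[p]}$ is the $K$-vector space whose basis is the set of infinite paths tail equivalent to $p$; on a basis element $q=f_1f_2\cdots$ a vertex $v$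 acts by $vq=q$ if $v=s(f_1)$ and $vq=0$ otherwise, an edge $e$ by $e\cdot q=eq$ if $r(e)=s(f_1)$ and $e\cdot q=0$ otherwise, and $e^*\cdot q=f_2f_3\cdots$ if $e=f_1$ and $e^*\cdot q=0$ otherwise. Write $c^\infty=ccc\cdots$. For $a\in L_K(E)$, the Prüfer module $U_{E,a}$ is the direct limit of the modules $L_K(E)/L_K(E)a^i$, $i\ge 1$, along the maps $L_K(E)/L_K(E)a^i\to L_K(E)/L_K(E)a^j$, $1+L_K(E)a^i\mapsto a^{j-i}+L_K(E)a^j$, for $i\le j$. A module is uniserial if its submodules are totally ordered by inclusion. Theorem. Let $c$ be a basic closed path in $E$. (1) For each $n\in\mathbb N$, the module $L_K(E)/L_K(E)(c-1)^n$ is uniserial and has a unique composition series, and all of its composition factors are isomorphic to $V_{[c^\infty]}$. (2) The Prüfer module $U_{E,c-1}$ is uniserial and artinian, and it is not noetherian. -/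

import Mathlib

/-- A directed graph `E = (E⁰, E¹, s, r)` with vertex set `V`, edge set `A`, and source and range
functions (loops and multiple edges allowed). -/
structure DirGraph (V : Type*) (A : Type*) where
  /-- the source of an edge -/
  s : A → V
  /-- the range of an edge -/
  r : A → V

namespace DirGraph

variable {V A : Type*}

/-! ### Closed paths -/

/-- A finite sequence of edges is a closed path `e₁ ⋯ eₙ`: `n ≥ 1`, `r(eᵢ) = s(eᵢ₊₁)` for
`1 ≤ i < n`, and `r(eₙ) = s(e₁)`. -/
def IsClosedPath (E : DirGraph V A) (c : List A) : Prop :=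
  ∃ h : c ≠ [], c.IsChain (fun e f => E.r e = E.s f) ∧ E.r (c.getLast h) = E.s (c.head h)

/-- A closed path is basic if it is not a proper power `δ ^ k`, `k ≥ 2`, of a closed path `δ`. -/
def IsBasicClosedPath (E : DirGraph V A) (c : List A) : Prop :=
  E.IsClosedPath c ∧
    ∀ d : List A, E.IsClosedPath d → ∀ k : ℕ, 2 ≤ k → c ≠ (List.replicate k d).flatten

/-! ### Infinite paths -/

/-- The infinite paths `e₁ e₂ e₃ ⋯` in `E` (indexed from `0`). -/
@[ext]
structure InfPath (E : DirGraph V A) where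
  /-- the sequence of edges -/
  edge : ℕ → A
  /-- consecutive edges are composable -/
  comp : ∀ i, E.r (edge i) = E.s (edge (i + 1))

namespace InfPath

variable {E : DirGraph V A}

/-- The source of the infinite path. -/
def source (p : E.InfPath) : V := E.s (p.edge 0)

/-- `p.drop n` is the infinite path `τ_{>n}(p)`: remove the first `n` edges. -/
def drop (n : ℕ) (p : E.InfPath) : E.InfPath :=
  ⟨fun i => p.edge (n + i), fun i => p.comp (n + i)⟩

/-- The infinite path `e p`, defined if `r(e) = s(p)`. -/
def cons (e : A) (p : E.InfPath) (h : E.r e = p.source) : E.InfPath :=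
  ⟨fun i => Nat.casesOn i e p.edge, fun i => by
    cases i with
    | zero => exact h
    | succ i => exact p.comp i⟩

/-- Tail equivalence of infinite paths. -/
def TailEquiv (p q : E.InfPath) : Prop := ∃ m n : ℕ, p.drop m = q.drop n

theorem TailEquiv.cons {p q : E.InfPath} (hq : q.TailEquiv p) (e : A) (h : E.r e = q.source) :
    (InfPath.cons e q h).TailEquiv p := by
  obtain ⟨m, n, hmn⟩ := hq
  refine ⟨m + 1, n, ?_⟩
  rw [← hmn]
  apply InfPath.ext
  funext i
  have : m + 1 + i = (m + i) + 1 := by omega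
  simp [InfPath.cons, InfPath.drop, this]

theorem TailEquiv.drop_one {p q : E.InfPath} (hq : q.TailEquiv p) : (q.drop 1).TailEquiv p := by
  obtain ⟨m, n, hmn⟩ := hq
  refine ⟨m, n + 1, ?_⟩
  apply InfPath.ext
  funext i
  have h := congrFun (congrArg InfPath.edge hmn) (1 + i)
  simp only [InfPath.drop] at h ⊢
  rw [show 1 + (m + i) = m + (1 + i) by omega, h, show n + 1 + i = n + (1 + i) by omega]

theorem cons_drop_one (q : E.InfPath) (h : E.r (q.edge 0) = (q.drop 1).source) :
    InfPath.cons (q.edge 0) (q.drop 1) h = q := by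
  apply InfPath.ext
  funext i
  cases i with
  | zero => rfl
  | succ i => exact congrArg q.edge (Nat.add_comm 1 i)

theorem drop_one_cons (e : A) (q : E.InfPath) (h : E.r e = q.source) :
    (InfPath.cons e q h).drop 1 = q := by
  apply InfPath.ext
  funext i
  change (InfPath.cons e q h).edge (1 + i) = q.edge i
  rw [Nat.add_comm]
  rfl

end InfPath

/-- The infinite path `c^∞ = c c c ⋯` of a closed path `c`. -/
def IsClosedPath.infPow {E : DirGraph V A} {c : List A} (hc : E.IsClosedPath c) : E.InfPath :=
  ⟨fun i => c.get ⟨i % c.length, Nat.mod_lt _ (List.length_pos_of_ne_nil hc.1)⟩, fun i => by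
    obtain ⟨h, hch, hcl⟩ := hc
    have hpos := List.length_pos_of_ne_nil h
    have hlt := Nat.mod_lt i hpos
    by_cases hi : i % c.length + 1 < c.length
    · have h2 : (i + 1) % c.length = i % c.length + 1 := by
        rw [Nat.add_mod, Nat.mod_eq_of_lt (show 1 < c.length by omega), Nat.mod_eq_of_lt hi]
      simp only [List.get_eq_getElem, h2]
      exact List.isChain_iff_getElem.1 hch _ hi
    · have h1 : i % c.length = c.length - 1 := by omega
      have h2 : (i + 1) % c.length = 0 := by
        have := Nat.div_add_mod i c.length
        have h3 : i + 1 = c.length * (i / c.length + 1) := by rw [Nat.mul_add]; omega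
        rw [h3, Nat.mul_mod_right]
      simp only [List.get_eq_getElem, h1, h2]
      rw [List.getLast_eq_getElem, List.head_eq_getElem] at hcl
      exact hcl⟩

/-! ### The Leavitt path algebra of a finite graph -/

/-- The generators `v`, `e`, `e^*` of the Leavitt path algebra. -/
inductive LGen (V : Type*) (A : Type*)
  | vert (v : V) : LGen V A
  | edge (e : A) : LGen V A
  | ghost (e : A) : LGen V A

section Leavitt

open FreeAlgebra LGen in
open Classical in
/-- The defining relations of the Leavitt path algebra of a finite graph. The last relation says
that the sum of the vertices is the identity; it is there because `FreeAlgebra` is the free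
*unital* algebra. -/
inductive LRel [Fintype V] [Fintype A] (K : Type*) [Field K] (E : DirGraph V A) :
    FreeAlgebra K (LGen V A) → FreeAlgebra K (LGen V A) → Prop
  | vv (v : V) : LRel K E (ι K (vert v) * ι K (vert v)) (ι K (vert v))
  | vu (v u : V) (h : v ≠ u) : LRel K E (ι K (vert v) * ι K (vert u)) 0
  | se (e : A) : LRel K E (ι K (vert (E.s e)) * ι K (edge e)) (ι K (edge e))
  | er (e : A) : LRel K E (ι K (edge e) * ι K (vert (E.r e))) (ι K (edge e))
  | rg (e : A) : LRel K E (ι K (vert (E.r e)) * ι K (ghost e)) (ι K (ghost e))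
  | gs (e : A) : LRel K E (ι K (ghost e) * ι K (vert (E.s e))) (ι K (ghost e))
  | ck1_same (e : A) : LRel K E (ι K (ghost e) * ι K (edge e)) (ι K (vert (E.r e)))
  | ck1_ne (e f : A) (h : e ≠ f) : LRel K E (ι K (ghost e) * ι K (edge f)) 0
  | ck2 (v : V) (h : ∃ e, E.s e = v) :
      LRel K E (ι K (vert v))
        (∑ e ∈ Finset.univ.filter (fun e => E.s e = v), ι K (edge e) * ι K (ghost e))
  | one : LRel K E (∑ v, ι K (vert v)) 1

/-- The Leavitt path algebra `L_K(E)` of the finite graph `E`. -/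
def LPA [Fintype V] [Fintype A] (K : Type*) [Field K] (E : DirGraph V A) : Type _ :=
  RingQuot (LRel K E)

noncomputable instance [Fintype V] [Fintype A] (K : Type*) [Field K] (E : DirGraph V A) :
    Ring (LPA K E) :=
  inferInstanceAs (Ring (RingQuot (LRel K E)))

noncomputable instance [Fintype V] [Fintype A] (K : Type*) [Field K] (E : DirGraph V A) :
    Algebra K (LPA K E) :=
  inferInstanceAs (Algebra K (RingQuot (LRel K E)))

/-- The element of `L_K(E)` given by a generator. -/
noncomputable def gen [Fintype V] [Fintype A] (K : Type*) [Field K] (E : DirGraph V A) (x : LGen V A) : LPA K E :=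
  RingQuot.mkAlgHom K (LRel K E) (FreeAlgebra.ι K x)

/-- The element `e₁ e₂ ⋯ eₙ` of `L_K(E)` given by a path of length `n ≥ 1`. -/
noncomputable def pathElem [Fintype V] [Fintype A] (K : Type*) [Field K] (E : DirGraph V A) (c : List A) : LPA K E :=
  (c.map fun e => gen K E (LGen.edge e)).prod

/-! ### Chen modules -/

/-- The underlying vector space of the Chen module `V_{[p]}`: its basis is the set of the infinite
paths that are tail equivalent to `p`. -/
def Chen (K : Type*) [Field K] (E : DirGraph V A) (p : E.InfPath) : Type _ :=
  {q : E.InfPath // q.TailEquiv p} →₀ K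

variable (K : Type*) [Field K] (E : DirGraph V A) (p : E.InfPath)

noncomputable instance : AddCommGroup (Chen K E p) :=
  inferInstanceAs (AddCommGroup ({q : E.InfPath // q.TailEquiv p} →₀ K))

noncomputable instance : Module K (Chen K E p) :=
  inferInstanceAs (Module K ({q : E.InfPath // q.TailEquiv p} →₀ K))

open Classical in
/-- The action of a generator on a basis element `q` of `V_{[p]}`. -/
noncomputable def chenBasisAct : LGen V A → {q : E.InfPath // q.TailEquiv p} →
    ({q : E.InfPath // q.TailEquiv p} →₀ K)
  | LGen.vert v, q => if v = q.1.source then Finsupp.single q 1 else 0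
  | LGen.edge e, q =>
      if h : E.r e = q.1.source then Finsupp.single ⟨InfPath.cons e q.1 h, q.2.cons e h⟩ 1 else 0
  | LGen.ghost e, q =>
      if e = q.1.edge 0 then Finsupp.single ⟨q.1.drop 1, q.2.drop_one⟩ 1 else 0

/-- The `K`-linear extension of the action of a generator. -/
noncomputable def chenGenAct (x : LGen V A) :
    Module.End K ({q : E.InfPath // q.TailEquiv p} →₀ K) :=
  Finsupp.linearCombination K (chenBasisAct K E p x)

theorem chenGenAct_single (x : LGen V A) (q : {q : E.InfPath // q.TailEquiv p}) :
    chenGenAct K E p x (Finsupp.single q 1) = chenBasisAct K E p x q := by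
  simp [chenGenAct]

variable [Fintype V] [Fintype A]

theorem chenGenAct_rel ⦃x y : FreeAlgebra K (LGen V A)⦄ (h : LRel K E x y) :
    FreeAlgebra.lift K (chenGenAct K E p) x = FreeAlgebra.lift K (chenGenAct K E p) y := by
  classical
  apply Finsupp.lhom_ext'
  intro q
  apply LinearMap.ext_ring
  have hs : ∀ (e : A) (q : E.InfPath) (h), (InfPath.cons e q h).source = E.s e := fun _ _ _ => rfl
  have h0 : ∀ (e : A) (q : E.InfPath) (h), (InfPath.cons e q h).edge 0 = e := fun _ _ _ => rfl
  have hd : ∀ (q : E.InfPath), (q.drop 1).source = E.r (q.edge 0) := fun q => (q.comp 0).symm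
  cases h with
  | vv v =>
    simp only [map_mul, FreeAlgebra.lift_ι_apply, LinearMap.comp_apply, Finsupp.lsingle_apply,
      Module.End.mul_apply, chenGenAct_single, chenBasisAct]
    split_ifs with h
    · simp [chenGenAct_single, chenBasisAct, h]
    · simp
  | vu v u hvu =>
    simp only [map_mul, FreeAlgebra.lift_ι_apply, LinearMap.comp_apply, Finsupp.lsingle_apply,
      Module.End.mul_apply, chenGenAct_single, chenBasisAct, map_zero, LinearMap.zero_apply]
    split_ifs with h
    · simp [chenGenAct_single, chenBasisAct, ← h, hvu]
    · simp
  | se e =>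
    simp only [map_mul, FreeAlgebra.lift_ι_apply, LinearMap.comp_apply, Finsupp.lsingle_apply,
      Module.End.mul_apply, chenGenAct_single, chenBasisAct]
    split_ifs with h
    · simp [chenGenAct_single, chenBasisAct, hs]
    · simp
  | er e =>
    simp only [map_mul, FreeAlgebra.lift_ι_apply, LinearMap.comp_apply, Finsupp.lsingle_apply,
      Module.End.mul_apply, chenGenAct_single, chenBasisAct]
    split_ifs with h
    · simp [chenGenAct_single, chenBasisAct, h]
    · simp
  | rg e =>
    simp only [map_mul, FreeAlgebra.lift_ι_apply, LinearMap.comp_apply, Finsupp.lsingle_apply,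
      Module.End.mul_apply, chenGenAct_single, chenBasisAct]
    split_ifs with h
    · simp [chenGenAct_single, chenBasisAct, hd, h]
    · simp
  | gs e =>
    simp only [map_mul, FreeAlgebra.lift_ι_apply, LinearMap.comp_apply, Finsupp.lsingle_apply,
      Module.End.mul_apply, chenGenAct_single, chenBasisAct]
    by_cases h : e = q.1.edge 0
    · have h' : E.s e = q.1.source := by rw [h]; rfl
      simp [chenGenAct_single, chenBasisAct, h']
    · rw [if_neg h]
      split_ifs
      · simp [chenGenAct_single, chenBasisAct, h]
      · simp
  | ck1_same e =>
    simp only [map_mul, FreeAlgebra.lift_ι_apply, LinearMap.comp_apply, Finsupp.lsingle_apply,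
      Module.End.mul_apply, chenGenAct_single, chenBasisAct]
    split_ifs with h
    · simp [chenGenAct_single, chenBasisAct, h0, InfPath.drop_one_cons]
    · simp
  | ck1_ne e f hef =>
    simp only [map_mul, FreeAlgebra.lift_ι_apply, LinearMap.comp_apply, Finsupp.lsingle_apply,
      Module.End.mul_apply, chenGenAct_single, chenBasisAct, map_zero, LinearMap.zero_apply]
    split_ifs with h
    · simp [chenGenAct_single, chenBasisAct, h0, hef]
    · simp
  | ck2 v hv =>
    simp only [map_mul, map_sum, FreeAlgebra.lift_ι_apply, LinearMap.comp_apply,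
      Finsupp.lsingle_apply, Module.End.mul_apply, chenGenAct_single, LinearMap.sum_apply]
    have key : ∀ e : A, chenGenAct K E p (LGen.edge e) (chenBasisAct K E p (LGen.ghost e) q)
        = if e = q.1.edge 0 then Finsupp.single q 1 else 0 := by
      intro e
      by_cases h : e = q.1.edge 0
      · subst h
        simp [chenBasisAct, chenGenAct_single, hd, InfPath.cons_drop_one]
      · simp [chenBasisAct, h]
    simp only [key, Finset.sum_ite_eq', Finset.mem_filter, Finset.mem_univ, true_and]
    by_cases h1 : v = q.1.source
    · simp [chenBasisAct, h1, InfPath.source]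
    · have h2 : ¬ E.s (q.1.edge 0) = v := fun h => h1 h.symm
      simp [chenBasisAct, h1, h2]
  | one =>
    simp [chenGenAct_single, chenBasisAct]

/-- The representation of `L_K(E)` on `V_{[p]}`. -/
noncomputable def chenRep :
    LPA K E →ₐ[K] Module.End K ({q : E.InfPath // q.TailEquiv p} →₀ K) :=
  RingQuot.liftAlgHom K ⟨FreeAlgebra.lift K (chenGenAct K E p), chenGenAct_rel K E p⟩

/-- The left `L_K(E)`-module structure of the Chen module `V_{[p]}`. -/
noncomputable instance : Module (LPA K E) (Chen K E p) :=
  Module.compHom ({q : E.InfPath // q.TailEquiv p} →₀ K) (chenRep K E p).toRingHom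

end Leavitt

end DirGraph

/-! ### Prüfer modules and uniserial modules -/

section Prufer

variable (R : Type*) [Ring R] (a : R)

/-- The left `R`-module `R / R aⁿ`. -/
abbrev QuotPow (n : ℕ) : Type _ := R ⧸ (Submodule.span R {a ^ n} : Submodule R R)

/-- The map `R / R aⁱ → R / R aʲ`, `1 + R aⁱ ↦ aʲ⁻ⁱ + R aʲ`, for `i ≤ j`. -/
noncomputable def quotPowMap (i j : ℕ) (h : i ≤ j) : QuotPow R a i →ₗ[R] QuotPow R a j :=
  Submodule.mapQ _ _ (LinearMap.toSpanSingleton R R (a ^ (j - i))) (by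
    rw [Submodule.span_singleton_le_iff_mem, Submodule.mem_comap]
    have : (LinearMap.toSpanSingleton R R (a ^ (j - i))) (a ^ i) = a ^ j := by
      rw [LinearMap.toSpanSingleton_apply, smul_eq_mul, ← pow_add, Nat.add_sub_cancel' h]
    rw [this]
    exact Submodule.mem_span_singleton_self _)

/-- The `a`-Prüfer module: the direct limit of the modules `R / R aⁱ`, `i ≥ 1`. -/
abbrev PruferModule : Type _ :=
  Module.DirectLimit (fun i : ℕ+ => QuotPow R a i)
    (fun i j (h : i ≤ j) => quotPowMap R a i j h)

/-- A module is uniserial if its submodules are totally ordered by inclusion. -/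
def IsUniserial (M : Type*) [AddCommGroup M] [Module R M] : Prop :=
  ∀ N P : Submodule R M, N ≤ P ∨ P ≤ N

end Prufer

/-! Write `R` for the Leavitt path algebra, `a = c - 1`, and `U` for the Prüfer module. The images
`u i` of the classes of `1` generate `U` and form a Jordan chain: `u 0 = 0` and `a • u (i + 1) = u
i`. The core of the proof is that the submodules of `U` are exactly the `R u i`, strictly increasing
in `i`, and `U` itself. The lattice is then a chain of type `ω + 1`, which gives (2). For (1), `R /
R aⁿ` embeds as `R u n`, whose submodules are `R u 0 < ⋯ < R u n`. Each factor is nonzero and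
generated by an element killed by `a`, and so is `V_[c^∞]` (by `c^∞`). As `R a` is maximal, all of
them are isomorphic to `R / R a`.

Strictness comes from the grading. If `x a = 0`, then `x c = x`; as `c` is homogeneous of positive
degree, the lowest component of `x` must vanish. So right multiplication by `a` is injective
(`eq_zero_of_mul_pathElem_sub_one`), the annihilator of `u i` is `R aⁱ`, and `R a ≠ R` because `a`
kills `c^∞ ≠ 0`.

That there are no other submodules is `eq_span_chain_mem`. Let `S` be the `K`-span of the `u i` and
`p = c^∞`. On `S` the path `c` acts as the identity plus a shift, hence invertibly, with inverse
`c*`; so `α α*` fixes `S` for every initial segment `α` of `p`. It follows that `U` is a sum of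
weight spaces indexed by the infinite paths tail equivalent to `p`. Distinct paths have distinct
initial segments, so the elements `α α*` isolate the components of any member of a submodule `N`,
and ghost paths carry each component into `N ∩ S` reversibly. Finally, an element of `S` generates
the same submodule as its leading `u j`, since `a` lowers the index. Basicness ensures that `p`
returns to itself only after multiples of `|c|` edges, where the ghost path is a power of `c*` and
preserves `S`. -/

namespace DirGraph

variable {V A : Type*}

/-! ### Periods and tails of infinite paths -/

namespace InfPath

variable {E : DirGraph V A}

theorem drop_zero (p : E.InfPath) : p.drop 0 = p :=
  InfPath.ext (funext fun i => congrArg p.edge (Nat.zero_add i))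

theorem drop_drop (p : E.InfPath) (m n : ℕ) : (p.drop m).drop n = p.drop (m + n) :=
  InfPath.ext (funext fun i => congrArg p.edge (Nat.add_assoc m n i).symm)

theorem source_drop_one (p : E.InfPath) : (p.drop 1).source = E.r (p.edge 0) :=
  (p.comp 0).symm

/-- If an infinite path has periods `m` and `n`, then it has period `gcd m n`. -/
theorem drop_gcd (p : E.InfPath) (m n : ℕ) (hm : p.drop m = p) (hn : p.drop n = p) :
    p.drop (m.gcd n) = p := by
  induction m, n using Nat.gcd.induction with
  | H0 n => simpa using hn
  | H1 m n _ ih =>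
    rw [Nat.gcd_rec]
    refine ih ?_ hm
    have hk : ∀ k : ℕ, p.drop (m * k) = p := by
      intro k
      induction k with
      | zero => exact p.drop_zero
      | succ k ihk => rw [Nat.mul_succ, ← drop_drop, ihk, hm]
    -- Euclid's step: after `m * (n / m)` edges, which are whole periods, dropping `n % m` more
    -- amounts to dropping `n`.
    conv_lhs => rw [← hk (n / m)]
    rw [drop_drop, Nat.div_add_mod, hn]

/-- Finitely many distinct infinite paths have distinct initial segments of some length. -/
theorem exists_forall_edge_ne (s : Finset E.InfPath) :
    ∃ N : ℕ, ∀ q ∈ s, ∀ q' ∈ s, q ≠ q' → ∃ i < N, q.edge i ≠ q'.edge i := by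
  classical
  have h : ∀ x : E.InfPath × E.InfPath, ∃ i, x.1 ≠ x.2 → x.1.edge i ≠ x.2.edge i := by
    intro x
    by_cases hx : x.1 = x.2
    · exact ⟨0, fun h => absurd hx h⟩
    · by_contra! hc
      exact hx (InfPath.ext (funext fun i => (hc i).2))
  choose f hf using h
  refine ⟨(s ×ˢ s).sup f + 1, fun q hq q' hq' hne => ⟨f (q, q'), ?_, hf (q, q') hne⟩⟩
  exact Nat.lt_succ_of_le (Finset.le_sup (f := f) (Finset.mk_mem_product hq hq'))

/-- If `p` has period `ℓ` and `q` is tail equivalent to `p`, then `p` is a tail of `q`. -/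
theorem TailEquiv.exists_drop_eq {p q : E.InfPath} {ℓ : ℕ} (hℓ : 0 < ℓ) (hp : p.drop ℓ = p)
    (h : q.TailEquiv p) : ∃ n, q.drop n = p := by
  obtain ⟨i, j, hij⟩ := h
  have hk : ∀ k, p.drop (ℓ * k) = p := by
    intro k
    induction k with
    | zero => exact p.drop_zero
    | succ k ih => rw [Nat.mul_succ, ← InfPath.drop_drop, ih, hp]
  -- After `i` edges `q` has become `p.drop j`; another `ℓ * j - j` edges complete `j` full periods.
  refine ⟨i + (ℓ * j - j), ?_⟩
  rw [← InfPath.drop_drop, hij, InfPath.drop_drop, Nat.add_sub_cancel' (Nat.le_mul_of_pos_left j hℓ),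
    hk]

end InfPath

namespace IsClosedPath

variable {E : DirGraph V A} {c : List A}

theorem length_pos (hc : E.IsClosedPath c) : 0 < c.length :=
  List.length_pos_of_ne_nil hc.1

theorem infPow_edge (hc : E.IsClosedPath c) (i : ℕ) (hi : i < c.length) :
    hc.infPow.edge i = (c)[i] := by
  simp [infPow, Nat.mod_eq_of_lt hi]

theorem infPow_drop_length (hc : E.IsClosedPath c) : hc.infPow.drop c.length = hc.infPow := by
  apply InfPath.ext
  funext i
  simp [infPow, InfPath.drop]

end IsClosedPath

/-- The period of `c^∞` is exactly the length of `c` if `c` is basic. -/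
theorem IsBasicClosedPath.length_dvd {E : DirGraph V A} {c : List A} (hc : E.IsBasicClosedPath c)
    {n : ℕ} (hn : hc.1.infPow.drop n = hc.1.infPow) : c.length ∣ n := by
  set p := hc.1.infPow with hp
  have hpos := hc.1.length_pos
  set g := c.length.gcd n with hg
  have hgp : p.drop g = p := p.drop_gcd _ _ hc.1.infPow_drop_length hn
  have hg0 : 0 < g := Nat.gcd_pos_of_pos_left _ hpos
  have hedge : ∀ i, p.edge (g + i) = p.edge i := fun i => congrFun (congrArg InfPath.edge hgp) i
  have hmul : ∀ k i, p.edge (g * k + i) = p.edge i := by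
    intro k i
    induction k with
    | zero => simp
    | succ k ih => rw [Nat.mul_succ, Nat.add_comm (g * k), Nat.add_assoc, hedge, ih]
  obtain ⟨k, hk⟩ : g ∣ c.length := Nat.gcd_dvd_left _ _
  by_contra hdvd
  -- `k = 0` would make `c` empty, and `k = 1` would make `g = c.length` a divisor of `n`.
  have hk2 : 2 ≤ k := by
    rcases k with _ | _ | k
    · omega
    · exact absurd (by rw [hk, zero_add, mul_one]; exact Nat.gcd_dvd_right _ _) hdvd
    · omega
  -- The first `g` edges of `p`: they close up because `g` is a period, and `c` is their `k`-th
  -- power, against basicness.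
  set d : List A := List.ofFn (fun i : Fin g => p.edge i) with hd
  have hdl : d.length = g := by simp [hd]
  have hdne : d ≠ [] := by
    intro h
    rw [h] at hdl
    simp at hdl
    omega
  have hdclosed : E.IsClosedPath d := by
    refine ⟨hdne, ?_, ?_⟩
    · rw [List.isChain_iff_getElem]
      intro i hi
      simpa [hd] using p.comp i
    · rw [List.getLast_eq_getElem, List.head_eq_getElem]
      have h := p.comp (g - 1)
      rw [Nat.sub_add_cancel hg0] at h
      have h0 := hedge 0
      rw [add_zero] at h0
      simpa [hd, h0] using h
  refine hc.2 d hdclosed k hk2 ?_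
  have key : ∀ k : ℕ, (List.replicate k d).flatten
      = List.ofFn (fun i : Fin (g * k) => p.edge i) := by
    intro k
    induction k with
    | zero => simp
    | succ k ih =>
      rw [List.replicate_succ', List.flatten_append, ih, List.flatten_singleton, hd]
      apply List.ext_getElem
      · simp [Nat.mul_succ]
      · intro i h1 h2
        simp only [List.length_ofFn] at h2
        rw [List.getElem_append]
        split_ifs with h
        · simp
        · simp only [List.length_ofFn, not_lt] at h
          simp only [List.getElem_ofFn, List.length_ofFn]
          conv_rhs => rw [← Nat.add_sub_cancel' h]
          rw [hmul]
  rw [key, ← hk]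
  apply List.ext_getElem
  · simp
  · intro i h1 h2
    simp [← hc.1.infPow_edge i h1, hp]

/-! ### Relations and initial segments in the Leavitt path algebra -/

section Leavitt

variable [Fintype V] [Fintype A] (K : Type*) [Field K] (E : DirGraph V A)

open LGen

theorem gen_rel {x y : FreeAlgebra K (LGen V A)} (h : LRel K E x y) :
    (RingQuot.mkAlgHom K (LRel K E) x : LPA K E) = RingQuot.mkAlgHom K (LRel K E) y :=
  RingQuot.mkAlgHom_rel K h

theorem vert_mul_self (v : V) : gen K E (vert v) * gen K E (vert v) = gen K E (vert v) :=
  (map_mul (RingQuot.mkAlgHom K (LRel K E)) _ _).symm.trans (gen_rel K E (.vv v))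

theorem vert_mul_of_ne {v u : V} (h : v ≠ u) : gen K E (vert v) * gen K E (vert u) = 0 :=
  (map_mul (RingQuot.mkAlgHom K (LRel K E)) _ _).symm.trans
    ((gen_rel K E (.vu v u h)).trans (map_zero (RingQuot.mkAlgHom K (LRel K E))))

theorem source_mul_edge (e : A) :
    gen K E (vert (E.s e)) * gen K E (edge e) = gen K E (edge e) :=
  (map_mul (RingQuot.mkAlgHom K (LRel K E)) _ _).symm.trans (gen_rel K E (.se e))

theorem edge_mul_range (e : A) :
    gen K E (edge e) * gen K E (vert (E.r e)) = gen K E (edge e) :=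
  (map_mul (RingQuot.mkAlgHom K (LRel K E)) _ _).symm.trans (gen_rel K E (.er e))

theorem range_mul_ghost (e : A) :
    gen K E (vert (E.r e)) * gen K E (ghost e) = gen K E (ghost e) :=
  (map_mul (RingQuot.mkAlgHom K (LRel K E)) _ _).symm.trans (gen_rel K E (.rg e))

theorem ghost_mul_source (e : A) :
    gen K E (ghost e) * gen K E (vert (E.s e)) = gen K E (ghost e) :=
  (map_mul (RingQuot.mkAlgHom K (LRel K E)) _ _).symm.trans (gen_rel K E (.gs e))

theorem ghost_mul_edge_self (e : A) :
    gen K E (ghost e) * gen K E (edge e) = gen K E (vert (E.r e)) :=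
  (map_mul (RingQuot.mkAlgHom K (LRel K E)) _ _).symm.trans (gen_rel K E (.ck1_same e))

theorem ghost_mul_edge_of_ne {e f : A} (h : e ≠ f) :
    gen K E (ghost e) * gen K E (edge f) = 0 :=
  (map_mul (RingQuot.mkAlgHom K (LRel K E)) _ _).symm.trans
    ((gen_rel K E (.ck1_ne e f h)).trans (map_zero (RingQuot.mkAlgHom K (LRel K E))))

open Classical in
theorem vert_eq_sum (v : V) (h : ∃ e, E.s e = v) :
    gen K E (vert v) = ∑ e ∈ Finset.univ.filter (fun e => E.s e = v),
      gen K E (edge e) * gen K E (ghost e) := by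
  refine (gen_rel K E (.ck2 v h)).trans ?_
  refine (map_sum (RingQuot.mkAlgHom K (LRel K E)) _ _).trans ?_
  exact Finset.sum_congr rfl fun e _ => map_mul (RingQuot.mkAlgHom K (LRel K E)) _ _

theorem sum_vert : ∑ v, gen K E (vert v) = 1 :=
  (map_sum (RingQuot.mkAlgHom K (LRel K E)) _ _).symm.trans
    ((gen_rel K E .one).trans (map_one (RingQuot.mkAlgHom K (LRel K E))))

variable {K E} in
/-- Induction principle for the Leavitt path algebra. -/
theorem LPA.induction {motive : LPA K E → Prop} (algebraMap : ∀ k, motive (algebraMap K _ k))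
    (gen : ∀ x, motive (gen K E x)) (mul : ∀ x y, motive x → motive y → motive (x * y))
    (add : ∀ x y, motive x → motive y → motive (x + y)) (x : LPA K E) : motive x := by
  obtain ⟨y, rfl⟩ := RingQuot.mkAlgHom_surjective K (LRel K E) x
  induction y using FreeAlgebra.induction with
  | grade0 k => rw [AlgHom.commutes]; exact algebraMap k
  | grade1 x => exact gen x
  | mul x y hx hy => rw [map_mul]; exact mul _ _ hx hy
  | add x y hx hy => rw [map_add]; exact add _ _ hx hy

variable {K E} in
/-- A subspace of an `L_K(E)`-module that is stable under the generators is a submodule. -/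
theorem smul_mem_of_gen_smul_mem {M : Type*} [AddCommGroup M] [Module (LPA K E) M] [Module K M]
    [IsScalarTower K (LPA K E) M] {S : Submodule K M} (h : ∀ x, ∀ m ∈ S, gen K E x • m ∈ S)
    (l : LPA K E) {m : M} (hm : m ∈ S) : l • m ∈ S := by
  induction l using LPA.induction generalizing m with
  | algebraMap k => rw [algebraMap_smul]; exact S.smul_mem k hm
  | gen x => exact h x m hm
  | mul x y hx hy => rw [mul_smul]; exact hx (hy hm)
  | add x y hx hy => rw [add_smul]; exact S.add_mem (hx hm) (hy hm)

/-! ### Initial segments of infinite paths in the Leavitt path algebra -/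

/-- The initial segment of length `n` of an infinite path, as an element of `L_K(E)`. -/
noncomputable def initElem : ℕ → E.InfPath → LPA K E
  | 0, q => gen K E (vert q.source)
  | n + 1, q => gen K E (edge (q.edge 0)) * initElem n (q.drop 1)

/-- The ghost path of the initial segment of length `n` of an infinite path. -/
noncomputable def initGhost : ℕ → E.InfPath → LPA K E
  | 0, q => gen K E (vert q.source)
  | n + 1, q => initGhost n (q.drop 1) * gen K E (ghost (q.edge 0))

theorem source_mul_initElem (n : ℕ) (q : E.InfPath) :
    gen K E (vert q.source) * initElem K E n q = initElem K E n q := by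
  cases n with
  | zero => exact vert_mul_self K E _
  | succ n => rw [initElem, ← mul_assoc]; congr 1; exact source_mul_edge K E _

theorem initElem_mul_source (n : ℕ) (q : E.InfPath) :
    initElem K E n q * gen K E (vert (q.drop n).source) = initElem K E n q := by
  induction n generalizing q with
  | zero => rw [InfPath.drop_zero]; exact vert_mul_self K E _
  | succ n ih =>
    have h := ih (q.drop 1)
    rw [InfPath.drop_drop, Nat.add_comm 1 n] at h
    rw [initElem, mul_assoc, h]

theorem initElem_add (m n : ℕ) (q : E.InfPath) :
    initElem K E (m + n) q = initElem K E m q * initElem K E n (q.drop m) := by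
  induction m generalizing q with
  | zero => rw [Nat.zero_add, InfPath.drop_zero]; exact (source_mul_initElem K E n q).symm
  | succ m ih =>
    rw [Nat.succ_add, initElem, ih, initElem, InfPath.drop_drop, Nat.add_comm 1 m, mul_assoc]

theorem initGhost_mul_source (n : ℕ) (q : E.InfPath) :
    initGhost K E n q * gen K E (vert q.source) = initGhost K E n q := by
  cases n with
  | zero => exact vert_mul_self K E _
  | succ n => rw [initGhost, mul_assoc]; congr 1; exact ghost_mul_source K E _

theorem initGhost_add (m n : ℕ) (q : E.InfPath) :
    initGhost K E (m + n) q = initGhost K E n (q.drop m) * initGhost K E m q := by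
  induction m generalizing q with
  | zero => rw [Nat.zero_add, InfPath.drop_zero]; exact (initGhost_mul_source K E n q).symm
  | succ m ih =>
    rw [Nat.succ_add, initGhost, ih, initGhost, InfPath.drop_drop, Nat.add_comm 1 m, mul_assoc]

theorem initGhost_mul_initElem (n : ℕ) (q : E.InfPath) :
    initGhost K E n q * initElem K E n q = gen K E (vert (q.drop n).source) := by
  induction n generalizing q with
  | zero => rw [InfPath.drop_zero]; exact vert_mul_self K E _
  | succ n ih =>
    rw [initGhost, initElem, mul_assoc, ← mul_assoc (gen K E (ghost _)), ghost_mul_edge_self,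
      ← InfPath.source_drop_one, source_mul_initElem, ih, InfPath.drop_drop, Nat.add_comm 1 n]

/-- Edges cancel in pairs up to the first place where the two paths differ, and there `e* f = 0`. -/
theorem initGhost_mul_initElem_of_ne {n : ℕ} {q q' : E.InfPath} {i : ℕ} (hi : i < n)
    (h : q.edge i ≠ q'.edge i) : initGhost K E n q * initElem K E n q' = 0 := by
  induction n generalizing q q' i with
  | zero => omega
  | succ n ih =>
    rw [initGhost, initElem, mul_assoc, ← mul_assoc (gen K E (ghost _))]
    by_cases h0 : q.edge 0 = q'.edge 0
    · rw [h0, ghost_mul_edge_self, ← InfPath.source_drop_one, source_mul_initElem]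
      cases i with
      | zero => exact absurd h0 h
      | succ i =>
        refine ih (i := i) (by omega) ?_
        simpa [InfPath.drop, Nat.add_comm 1 i] using h
    · rw [ghost_mul_edge_of_ne K E h0, zero_mul, mul_zero]

theorem initElem_mul_initGhost_mul_initElem (n : ℕ) (q : E.InfPath) :
    initElem K E n q * (initGhost K E n q * initElem K E n q) = initElem K E n q := by
  rw [initGhost_mul_initElem, initElem_mul_source]

theorem initElem_eq_prod (n : ℕ) (q : E.InfPath) :
    initElem K E n q = ((List.ofFn fun i : Fin n => q.edge i).map
      fun e => gen K E (edge e)).prod * gen K E (vert (q.drop n).source) := by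
  induction n generalizing q with
  | zero => simp [initElem, InfPath.drop_zero]
  | succ n ih =>
    rw [initElem, ih, List.ofFn_succ, List.map_cons, List.prod_cons, InfPath.drop_drop,
      Nat.add_comm 1 n, mul_assoc]
    simp [InfPath.drop, Nat.add_comm 1]

variable {E}

/-- `initElem` ends in a vertex and `pathElem` does not; as `c` is nonempty, its last edge absorbs
that vertex. -/
theorem pathElem_eq_initElem {c : List A} (hc : E.IsClosedPath c) :
    pathElem K E c = initElem K E c.length hc.infPow := by
  rw [initElem_eq_prod]
  have h : (List.ofFn fun i : Fin c.length => hc.infPow.edge i) = c := by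
    apply List.ext_getElem
    · simp
    · intro i h1 h2
      simp [hc.infPow_edge i h2]
  rw [h, pathElem, hc.infPow_drop_length]
  obtain ⟨hne, hch, hcl⟩ := id hc
  have hs : hc.infPow.source = E.r (c.getLast hne) := by
    rw [hcl, InfPath.source, hc.infPow_edge 0 hc.length_pos, List.head_eq_getElem]
  rw [hs]
  conv_lhs => rw [← List.dropLast_append_getLast hne]
  conv_rhs => enter [1, 1, 2]; rw [← List.dropLast_append_getLast hne]
  simp only [List.map_append, List.prod_append, List.map_cons, List.map_nil, List.prod_cons,
    List.prod_nil, mul_one, mul_assoc, edge_mul_range]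

end Leavitt

end DirGraph

namespace DirGraph

/-! ### The grading and right cancellation of `c - 1` -/

section Grading

variable {V A : Type*} [Fintype V] [Fintype A] (K : Type*) [Field K] (E : DirGraph V A)

open LGen AddMonoidAlgebra

/-- The degree of a generator. -/
def LGen.deg : LGen V A → ℤ
  | vert _ => 0
  | edge _ => 1
  | ghost _ => -1

/-- The homogeneous element of `L_K(E)[ℤ]` given by a generator. -/
noncomputable def genHomog (x : LGen V A) : AddMonoidAlgebra (LPA K E) ℤ :=
  AddMonoidAlgebra.single x.deg (gen K E x)

/-- Every defining relation is homogeneous for the degrees `0`, `1`, `-1` of vertices, edges and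
ghost edges. -/
theorem genHomog_rel ⦃x y : FreeAlgebra K (LGen V A)⦄ (h : LRel K E x y) :
    FreeAlgebra.lift K (genHomog K E) x = FreeAlgebra.lift K (genHomog K E) y := by
  have hs : ∀ s : Finset A, single (0 : ℤ) (∑ e ∈ s, gen K E (edge e) * gen K E (ghost e))
      = ∑ e ∈ s, single (0 : ℤ) (gen K E (edge e) * gen K E (ghost e)) :=
    fun s => map_sum (singleAddHom (0 : ℤ)) _ s
  have hv : ∑ v, single (0 : ℤ) (gen K E (vert v)) = 1 := by
    rw [one_def, ← sum_vert]
    exact (map_sum (singleAddHom (0 : ℤ)) _ _).symm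
  cases h <;> simp only [map_mul, map_zero, map_one, map_sum, FreeAlgebra.lift_ι_apply, genHomog,
    LGen.deg, single_mul_single, add_zero, zero_add, neg_add_cancel, add_neg_cancel, hv,
    vert_mul_self, source_mul_edge, edge_mul_range, range_mul_ghost, ghost_mul_source,
    ghost_mul_edge_self]
  case vu v u h => rw [vert_mul_of_ne K E h, single_zero]
  case ck1_ne e f h => rw [ghost_mul_edge_of_ne K E h, single_zero]
  case ck2 v h => rw [vert_eq_sum K E v h, hs]

/-- The coaction of `ℤ` on `L_K(E)` that describes its grading. -/
noncomputable def gradingHom : LPA K E →ₐ[K] AddMonoidAlgebra (LPA K E) ℤ :=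
  RingQuot.liftAlgHom K ⟨FreeAlgebra.lift K (genHomog K E), genHomog_rel K E⟩

theorem gradingHom_gen (x : LGen V A) :
    gradingHom K E (gen K E x) = AddMonoidAlgebra.single x.deg (gen K E x) := by
  refine (RingQuot.liftAlgHom_mkAlgHom_apply K _ (genHomog_rel K E) _).trans ?_
  simp [genHomog]

/-- The sum of the coefficients. -/
noncomputable def coeffSum : AddMonoidAlgebra (LPA K E) ℤ →ₐ[K] LPA K E :=
  AddMonoidAlgebra.liftNCAlgHom (AlgHom.id K _) 1 fun _ _ => Commute.one_right _

/-- Makes `gradingHom` injective, so a vanishing statement can be checked in `R[ℤ]`, where degrees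
are visible. -/
theorem coeffSum_gradingHom (x : LPA K E) : coeffSum K E (gradingHom K E x) = x := by
  induction x using LPA.induction with
  | algebraMap k => rw [AlgHom.commutes, AlgHom.commutes]
  | gen x => simp [gradingHom_gen, coeffSum, -LaurentPolynomial.single_eq_C_mul_T]
  | mul x y hx hy => rw [map_mul, map_mul, hx, hy]
  | add x y hx hy => rw [map_add, map_add, hx, hy]

theorem gradingHom_pathElem (c : List A) :
    gradingHom K E (pathElem K E c) = AddMonoidAlgebra.single (c.length : ℤ) (pathElem K E c) := by
  induction c with
  | nil => exact (map_one _).trans one_def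
  | cons e c ih =>
    have h : pathElem K E (e :: c) = gen K E (edge e) * pathElem K E c := by simp [pathElem]
    rw [h, map_mul, gradingHom_gen, ih, single_mul_single]
    simp only [LGen.deg, List.length_cons, Nat.cast_add, Nat.cast_one, add_comm]

/-- An element of `R[ℤ]` that is fixed by the multiplication by a homogeneous element of positive
degree is zero. -/
theorem eq_zero_of_mul_single_eq_self {R : Type*} [Ring R] (y : AddMonoidAlgebra R ℤ) (n : ℤ)
    (hn : 0 < n) (r : R) (h : y * AddMonoidAlgebra.single n r = y) : y = 0 := by
  by_contra hy
  have hne : y.coeff.support.Nonempty := by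
    rw [Finset.nonempty_iff_ne_empty]
    intro h0
    apply hy
    ext i
    simpa using congrArg (fun f => f i) (Finsupp.support_eq_empty.1 h0)
  set d := y.coeff.support.min' hne
  have hd : y.coeff d ≠ 0 := Finsupp.mem_support_iff.1 (Finset.min'_mem _ hne)
  -- `d` is the lowest degree of `y`, and the coefficient of `y * single n r` at `d` is that of `y`
  -- at `d - n`, times `r`.
  have h2 : y.coeff (d - n) = 0 := by
    by_contra h3
    have := Finset.min'_le _ _ (Finsupp.mem_support_iff.2 h3)
    change d ≤ d - n at this
    omega
  apply hd
  rw [← h]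
  rw [coeff_mul_single_eq_coeff_mul (d - n) fun d' _ => ⟨fun h => by omega, fun h => by omega⟩,
    h2, zero_mul]

theorem eq_zero_of_mul_pathElem_sub_one {c : List A} (hc : c ≠ []) {x : LPA K E}
    (h : x * (pathElem K E c - 1) = 0) : x = 0 := by
  have h1 : x * pathElem K E c = x := by rwa [mul_sub, mul_one, sub_eq_zero] at h
  have h2 : gradingHom K E x * AddMonoidAlgebra.single (c.length : ℤ) (pathElem K E c)
      = gradingHom K E x := by
    rw [← gradingHom_pathElem, ← map_mul, h1]
  have h3 := eq_zero_of_mul_single_eq_self _ _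
    (by exact_mod_cast List.length_pos_of_ne_nil hc) _ h2
  rw [← coeffSum_gradingHom K E x, h3, map_zero]

theorem eq_zero_of_mul_pathElem_sub_one_pow {c : List A} (hc : c ≠ []) (n : ℕ) {x : LPA K E}
    (h : x * (pathElem K E c - 1) ^ n = 0) : x = 0 := by
  induction n with
  | zero => simpa using h
  | succ n ih =>
    rw [pow_succ, ← mul_assoc] at h
    exact ih (eq_zero_of_mul_pathElem_sub_one K E hc h)

end Grading

end DirGraph

namespace DirGraph

/-! ### Weight spaces over infinite paths -/

section WeightSpaces

variable {V A : Type*} [Fintype V] [Fintype A] {K : Type*} [Field K] {E : DirGraph V A}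
  {M : Type*} [AddCommGroup M] [Module (LPA K E) M] [Module K M]

open LGen

/-- The elements of `M` that lie over an infinite path `q`, with values in the subspace `S` along
the tails of `q` that are equal to `p`. -/
def weightSpace [IsScalarTower K (LPA K E) M] (p : E.InfPath) (S : Submodule K M)
    (q : E.InfPath) : Submodule K M where
  carrier := {m | (∀ n, (initElem K E n q * initGhost K E n q) • m = m) ∧
    ∀ n, q.drop n = p → initGhost K E n q • m ∈ S}
  add_mem' ha hb := ⟨fun n => by rw [smul_add, ha.1, hb.1],
    fun n hn => by rw [smul_add]; exact S.add_mem (ha.2 n hn) (hb.2 n hn)⟩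
  zero_mem' := ⟨fun n => smul_zero _, fun n _ => by rw [smul_zero]; exact S.zero_mem⟩
  smul_mem' k m hm := ⟨fun n => by rw [smul_algebra_smul_comm, hm.1],
    fun n hn => by rw [smul_algebra_smul_comm]; exact S.smul_mem k (hm.2 n hn)⟩

variable [IsScalarTower K (LPA K E) M] {p q : E.InfPath} {S : Submodule K M} {m : M}

theorem source_smul_of_mem_weightSpace (hm : m ∈ weightSpace p S q) :
    gen K E (vert q.source) • m = m := by
  have h := hm.1 0
  rwa [initElem, initGhost, vert_mul_self] at h

theorem vert_smul_of_mem_weightSpace (hm : m ∈ weightSpace p S q) {v : V} (hv : v ≠ q.source) :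
    gen K E (vert v) • m = 0 := by
  rw [← source_smul_of_mem_weightSpace hm, ← mul_smul, vert_mul_of_ne K E hv, zero_smul]

theorem edge_smul_of_mem_weightSpace (hm : m ∈ weightSpace p S q) {e : A}
    (he : E.r e ≠ q.source) : gen K E (edge e) • m = 0 := by
  rw [← edge_mul_range, mul_smul, vert_smul_of_mem_weightSpace hm he, smul_zero]

theorem ghost_smul_of_mem_weightSpace (hm : m ∈ weightSpace p S q) {e : A}
    (he : e ≠ q.edge 0) : gen K E (ghost e) • m = 0 := by
  rw [← hm.1 1, initElem, ← mul_smul, ← mul_assoc, ← mul_assoc, ghost_mul_edge_of_ne K E he,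
    zero_mul, zero_mul, zero_smul]

theorem ghost_smul_mem_weightSpace (hm : m ∈ weightSpace p S q) :
    gen K E (ghost (q.edge 0)) • m ∈ weightSpace p S (q.drop 1) := by
  refine ⟨fun n => ?_, fun n hn => ?_⟩
  · conv_rhs => rw [← hm.1 (n + 1), ← mul_smul, initElem, ← mul_assoc, ← mul_assoc,
      ghost_mul_edge_self, ← InfPath.source_drop_one, source_mul_initElem, mul_smul]
    rw [initGhost, mul_smul, mul_smul]
  · rw [← mul_smul]
    rw [InfPath.drop_drop, Nat.add_comm] at hn
    exact hm.2 (n + 1) hn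

/-- Prepending `e` shifts all conditions by one, except for a new one at `n = 0` when `e q = p`;
periodicity and stability of `S` under the period of `p` serve only there. -/
theorem edge_smul_mem_weightSpace (hm : m ∈ weightSpace p S q) {e : A} (he : E.r e = q.source)
    {ℓ : ℕ} (hℓ : 0 < ℓ) (hp : p.drop ℓ = p) (hS : ∀ w ∈ S, initElem K E ℓ p • w ∈ S) :
    gen K E (edge e) • m ∈ weightSpace p S (InfPath.cons e q he) := by
  have hd := InfPath.drop_one_cons e q he
  have h0 : (InfPath.cons e q he).edge 0 = e := rfl
  have hG : ∀ n, initGhost K E (n + 1) (InfPath.cons e q he) • gen K E (edge e) • m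
      = initGhost K E n q • m := by
    intro n
    rw [initGhost, hd, h0, mul_smul, ← mul_smul (gen K E (ghost e)), ghost_mul_edge_self, he,
      source_smul_of_mem_weightSpace hm]
  refine ⟨fun n => ?_, fun n hn => ?_⟩
  · cases n with
    | zero =>
      rw [initElem, initGhost, vert_mul_self, ← mul_smul]
      exact congrArg (· • m) (source_mul_edge K E e)
    | succ n => rw [mul_smul, hG, initElem, hd, h0, mul_smul, ← mul_smul (initElem K E n q), hm.1]
  · cases n with
    | zero =>
      rw [InfPath.drop_zero] at hn
      have hq : q.drop (ℓ - 1) = p := by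
        rw [← hd, InfPath.drop_drop, Nat.add_sub_cancel' hℓ, hn, hp]
      -- As `e q = p`, the edge `e` followed by the first `ℓ - 1` edges of `q` is the period of `p`;
      -- the remaining factor lies in `S` since `q.drop (ℓ - 1) = p`.
      have h1 : gen K E (edge e) • m = initElem K E ℓ p • (initGhost K E (ℓ - 1) q • m) := by
        obtain ⟨k, rfl⟩ : ∃ k, ℓ = k + 1 := ⟨ℓ - 1, by omega⟩
        conv_lhs => rw [← hm.1 k]
        conv_rhs => rw [← hn, initElem, hd, h0]
        rw [mul_smul, mul_smul, Nat.add_sub_cancel]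
      have h2 : initGhost K E 0 (InfPath.cons e q he) • gen K E (edge e) • m
          = gen K E (edge e) • m := by
        rw [← mul_smul]
        exact congrArg (· • m) (source_mul_edge K E e)
      rw [h2, h1]
      exact hS _ (hm.2 _ hq)
    | succ n =>
      rw [hG]
      refine hm.2 n ?_
      rw [← hn, Nat.add_comm, ← InfPath.drop_drop, hd]

/-- The sum of the weight spaces of the infinite paths that are tail equivalent to `p` is a
submodule. -/
theorem smul_mem_iSup_weightSpace {ℓ : ℕ} (hℓ : 0 < ℓ) (hp : p.drop ℓ = p)
    (hS : ∀ w ∈ S, initElem K E ℓ p • w ∈ S) (l : LPA K E)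
    (hm : m ∈ ⨆ q : {q : E.InfPath // q.TailEquiv p}, weightSpace p S q.1) :
    l • m ∈ ⨆ q : {q : E.InfPath // q.TailEquiv p}, weightSpace p S q.1 := by
  refine smul_mem_of_gen_smul_mem (fun x m hm => ?_) l hm
  induction hm using Submodule.iSup_induction' with
  | zero => rw [smul_zero]; exact Submodule.zero_mem _
  | add a b _ _ ha hb => rw [smul_add]; exact Submodule.add_mem _ ha hb
  | mem q m hm =>
    have key : ∀ (q' : E.InfPath) (h : q'.TailEquiv p) {y : M}, y ∈ weightSpace p S q' →
        y ∈ ⨆ q : {q : E.InfPath // q.TailEquiv p}, weightSpace p S q.1 :=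
      fun q' h y hy => Submodule.mem_iSup_of_mem ⟨q', h⟩ hy
    cases x with
    | vert v =>
      by_cases hv : v = q.1.source
      · rw [hv, source_smul_of_mem_weightSpace hm]; exact key _ q.2 hm
      · rw [vert_smul_of_mem_weightSpace hm hv]; exact Submodule.zero_mem _
    | edge e =>
      by_cases he : E.r e = q.1.source
      · exact key _ (q.2.cons e he) (edge_smul_mem_weightSpace hm he hℓ hp hS)
      · rw [edge_smul_of_mem_weightSpace hm he]; exact Submodule.zero_mem _
    | ghost e =>
      by_cases he : e = q.1.edge 0
      · rw [he]; exact key _ q.2.drop_one (ghost_smul_mem_weightSpace hm)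
      · rw [ghost_smul_of_mem_weightSpace hm he]; exact Submodule.zero_mem _

/-- If `M` is the sum of the weight spaces of the infinite paths that are tail equivalent to `p`,
then every submodule of `M` is generated by its elements in `S`. -/
theorem le_span_inter_of_iSup_weightSpace_eq_top {ℓ : ℕ} (hℓ : 0 < ℓ) (hp : p.drop ℓ = p)
    (htop : (⨆ q : {q : E.InfPath // q.TailEquiv p}, weightSpace p S q.1) = ⊤)
    (N : Submodule (LPA K E) M) : N ≤ Submodule.span (LPA K E) {w | w ∈ N ∧ w ∈ S} := by
  classical
  intro m hm
  have h1 : m ∈ ⨆ q : {q : E.InfPath // q.TailEquiv p}, weightSpace p S q.1 := by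
    rw [htop]; trivial
  obtain ⟨f, hf, rfl⟩ := (Submodule.mem_iSup_iff_exists_finsupp _ _).1 h1
  obtain ⟨n, hn⟩ := InfPath.exists_forall_edge_ne (f.support.map (Function.Embedding.subtype _))
  -- At length `n` the paths in the support have distinct initial segments, so `α α*` for that of
  -- `q` kills every component but `f q`.
  have hcomp : ∀ q ∈ f.support, (initElem K E n q.1 * initGhost K E n q.1) •
      (f.sum fun _ x => x) = f q := by
    intro q hq
    rw [Finsupp.sum, Finset.smul_sum, Finset.sum_eq_single q]
    · exact (hf q).1 n
    · intro q' hq' hne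
      obtain ⟨i, hi, hne'⟩ := hn q.1 (Finset.mem_map_of_mem _ hq) q'.1 (Finset.mem_map_of_mem _ hq')
        (fun h => hne (Subtype.ext h).symm)
      rw [← (hf q').1 n, ← mul_smul, mul_assoc, ← mul_assoc (initGhost K E n q.1),
        initGhost_mul_initElem_of_ne K E hi hne', zero_mul, mul_zero, zero_smul]
    · intro h; exact absurd hq h
  refine Submodule.sum_mem _ fun q hq => ?_
  have hq1 : f q ∈ N := by rw [← hcomp q hq]; exact N.smul_mem _ hm
  obtain ⟨k, hk⟩ := q.2.exists_drop_eq hℓ hp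
  change f q ∈ _
  -- The ghost path down to the tail `p` moves `f q` into `N ∩ S`, and the path itself moves it
  -- back.
  rw [← (hf q).1 k, mul_smul]
  exact Submodule.smul_mem _ _ (Submodule.subset_span ⟨N.smul_mem _ hq1, (hf q).2 k hk⟩)

end WeightSpaces

/-! ### Jordan chains and the submodules they generate -/

section JordanChain

variable {V A : Type*} [Fintype V] [Fintype A] {K : Type*} [Field K] {E : DirGraph V A}
  {M : Type*} [AddCommGroup M] [Module (LPA K E) M] {u : ℕ → M}

section

variable {R : Type*} [Ring R] {M : Type*} [AddCommGroup M] [Module R M] {a : R} {u : ℕ → M}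

theorem chain_mem_of_le (hu : ∀ i, a • u (i + 1) = u i) {N : Submodule R M} {i j : ℕ}
    (hij : i ≤ j) (hj : u j ∈ N) : u i ∈ N := by
  induction hij with
  | refl => exact hj
  | step _ ih => exact ih (by rw [← hu]; exact N.smul_mem _ hj)

/-- The combinations of a Jordan chain generate the same submodules as the members of the chain. -/
theorem exists_span_eq_span_chain [Algebra K R] [Module K M] [IsScalarTower K R M]
    (hu0 : u 0 = 0) (hu : ∀ i, a • u (i + 1) = u i) {w : M}
    (hw : w ∈ Submodule.span K (Set.range u)) :
    ∃ j, Submodule.span R {w} = Submodule.span R {u j} := by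
  have hsm : ∀ (N : Submodule R M) (k : K) {x : M}, x ∈ N → k • x ∈ N := fun N k x hx => by
    rw [← algebraMap_smul R k x]; exact N.smul_mem _ hx
  have ha : ∀ i, ∀ x ∈ Submodule.span K (u '' Set.Iio (i + 1)),
      a • x ∈ Submodule.span K (u '' Set.Iio i) := by
    intro i x hx
    induction hx using Submodule.span_induction with
    | mem x hx =>
      obtain ⟨j, hj, rfl⟩ := hx
      cases j with
      | zero => rw [hu0, smul_zero]; exact Submodule.zero_mem _
      | succ j => rw [hu]; exact Submodule.subset_span ⟨j, Nat.lt_of_succ_lt_succ hj, rfl⟩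
    | zero => rw [smul_zero]; exact Submodule.zero_mem _
    | add x y _ _ hx hy => rw [smul_add]; exact Submodule.add_mem _ hx hy
    | smul k x _ hx => rw [smul_algebra_smul_comm]; exact Submodule.smul_mem _ _ hx
  have hle : ∀ (N : Submodule R M) i, (∀ j < i, u j ∈ N) →
      ∀ x ∈ Submodule.span K (u '' Set.Iio i), x ∈ N := by
    intro N i h x hx
    induction hx using Submodule.span_induction with
    | mem x hx => obtain ⟨j, hj, rfl⟩ := hx; exact h j hj
    | zero => exact N.zero_mem
    | add x y _ _ hx hy => exact N.add_mem hx hy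
    | smul k x _ hx => exact hsm N k hx
  -- Leading terms can be extracted: applying `a` lowers all indices by one, so induction puts `u
  -- i`, hence every lower member and `x`, into `N`; what is left is `k • u (i + 1)`.
  have hlead : ∀ i, ∀ k : K, k ≠ 0 → ∀ x ∈ Submodule.span K (u '' Set.Iio i),
      ∀ N : Submodule R M, k • u i + x ∈ N → u i ∈ N := by
    intro i
    induction i with
    | zero => intro k _ x _ N _; rw [hu0]; exact N.zero_mem
    | succ i ih =>
      intro k hk x hx N hN
      have h1 : u i ∈ N := by
        refine ih k hk (a • x) (ha i x hx) N ?_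
        have := N.smul_mem a hN
        rwa [smul_add, smul_algebra_smul_comm, hu] at this
      have h2 : x ∈ N := hle N (i + 1) (fun j hj => chain_mem_of_le hu (Nat.le_of_lt_succ hj) h1) x hx
      have h3 : k • u (i + 1) ∈ N := (N.add_mem_iff_left h2).1 hN
      have h4 := hsm N k⁻¹ h3
      rwa [smul_smul, inv_mul_cancel₀ hk, one_smul] at h4
  have hmain : ∀ i, ∀ x ∈ Submodule.span K (u '' Set.Iio i),
      ∃ j, Submodule.span R {x} = Submodule.span R {u j} := by
    intro i
    induction i with
    | zero =>
      intro x hx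
      have : x = 0 := by simpa using hx
      exact ⟨0, by rw [this, hu0]⟩
    | succ i ih =>
      intro x hx
      rw [← Order.succ_eq_add_one, Order.Iio_succ_eq_insert, Set.image_insert_eq,
        Submodule.mem_span_insert] at hx
      obtain ⟨k, y, hy, rfl⟩ := hx
      by_cases hk : k = 0
      · rw [hk, zero_smul, zero_add]; exact ih y hy
      · refine ⟨i, le_antisymm ?_ ?_⟩
        · rw [Submodule.span_singleton_le_iff_mem]
          have hui := Submodule.mem_span_singleton_self (R := R) (u i)
          exact Submodule.add_mem _ (hsm _ k hui)
            (hle _ i (fun j hj => chain_mem_of_le hu hj.le hui) y hy)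
        · rw [Submodule.span_singleton_le_iff_mem]
          exact hlead i k hk y hy _ (Submodule.mem_span_singleton_self _)
  have hex : ∃ i, w ∈ Submodule.span K (u '' Set.Iio i) := by
    induction hw using Submodule.span_induction with
    | mem x hx =>
      obtain ⟨j, rfl⟩ := hx
      exact ⟨j + 1, Submodule.subset_span ⟨j, Nat.lt_succ_self j, rfl⟩⟩
    | zero => exact ⟨0, Submodule.zero_mem _⟩
    | add x y _ _ hx hy =>
      obtain ⟨i, hi⟩ := hx
      obtain ⟨j, hj⟩ := hy
      have hmono : ∀ {i j : ℕ}, i ≤ j →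
          Submodule.span K (u '' Set.Iio i) ≤ Submodule.span K (u '' Set.Iio j) :=
        fun h => Submodule.span_mono (Set.image_mono (Set.Iio_subset_Iio h))
      exact ⟨max i j, Submodule.add_mem _ (hmono (le_max_left i j) hi)
        (hmono (le_max_right i j) hj)⟩
    | smul k x _ hx =>
      obtain ⟨i, hi⟩ := hx
      exact ⟨i, Submodule.smul_mem _ _ hi⟩
  obtain ⟨i, hi⟩ := hex
  exact hmain i w hi

end

/-- A module over `L_K(E)` that is generated by a Jordan chain of the basic closed path `c` with
eigenvalue `1`: each of its submodules is generated by members of the chain. -/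
theorem eq_span_chain_mem {c : List A} (hc : E.IsBasicClosedPath c) (hu0 : u 0 = 0)
    (hu : ∀ i, (pathElem K E c - 1) • u (i + 1) = u i)
    (htop : Submodule.span (LPA K E) (Set.range u) = ⊤) (N : Submodule (LPA K E) M) :
    N = Submodule.span (LPA K E) {w | w ∈ N ∧ w ∈ Set.range u} := by
  let : Module K M := Module.compHom M (algebraMap K (LPA K E))
  have : IsScalarTower K (LPA K E) M := IsScalarTower.of_algebraMap_smul fun _ _ => rfl
  set p := hc.1.infPow with hpdef
  set ℓ := c.length
  have hℓ : 0 < ℓ := hc.1.length_pos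
  have hp : p.drop ℓ = p := hc.1.infPow_drop_length
  set S : Submodule K M := Submodule.span K (Set.range u) with hS
  have hSind : ∀ x : LPA K E, (∀ i, x • u i ∈ S) → ∀ w ∈ S, x • w ∈ S := by
    intro x hx w hw
    induction hw using Submodule.span_induction with
    | mem w hw => obtain ⟨i, rfl⟩ := hw; exact hx i
    | zero => rw [smul_zero]; exact S.zero_mem
    | add x y _ _ hx hy => rw [smul_add]; exact S.add_mem hx hy
    | smul k x _ hx => rw [smul_algebra_smul_comm]; exact S.smul_mem _ hx
  have huS : ∀ i, u i ∈ S := fun i => Submodule.subset_span ⟨i, rfl⟩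
  have hcu : ∀ i, initElem K E ℓ p • u (i + 1) = u (i + 1) + u i := by
    intro i
    rw [← hu i, ← pathElem_eq_initElem, sub_smul, one_smul, add_sub_cancel]
  have hcS : ∀ w ∈ S, initElem K E ℓ p • w ∈ S := by
    refine hSind _ fun i => ?_
    cases i with
    | zero => rw [hu0, smul_zero]; exact S.zero_mem
    | succ i => rw [hcu]; exact S.add_mem (huS _) (huS _)
  -- Since `c u (i + 1) = u (i + 1) + u i` and `u i = c y`, the element `u (i + 1) - y` is a
  -- preimage of `u (i + 1)`.
  have hsurj : ∀ i, ∃ y ∈ S, u i = initElem K E ℓ p • y := by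
    intro i
    induction i with
    | zero => exact ⟨0, S.zero_mem, by rw [hu0, smul_zero]⟩
    | succ i ih =>
      obtain ⟨y, hy, hiy⟩ := ih
      refine ⟨u (i + 1) - y, S.sub_mem (huS _) hy, ?_⟩
      rw [smul_sub, ← hiy, hcu, add_sub_cancel_right]
  have hsurjS : ∀ w ∈ S, ∃ y ∈ S, w = initElem K E ℓ p • y := by
    intro w hw
    induction hw using Submodule.span_induction with
    | mem w hw => obtain ⟨i, rfl⟩ := hw; exact hsurj i
    | zero => exact ⟨0, S.zero_mem, by rw [smul_zero]⟩
    | add x y _ _ hx hy =>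
      obtain ⟨x', hx', rfl⟩ := hx
      obtain ⟨y', hy', rfl⟩ := hy
      exact ⟨x' + y', S.add_mem hx' hy', by rw [smul_add]⟩
    | smul k x _ hx =>
      obtain ⟨x', hx', rfl⟩ := hx
      exact ⟨k • x', S.smul_mem _ hx', by rw [smul_algebra_smul_comm]⟩
  have hvS : ∀ w ∈ S, gen K E (.vert p.source) • w = w := by
    intro w hw
    obtain ⟨y, -, rfl⟩ := hsurjS w hw
    rw [← mul_smul, source_mul_initElem]
  -- An element of `S` has the form `c y` with `y ∈ S`, and `c* c y = y`.
  have hgS : ∀ w ∈ S, initGhost K E ℓ p • w ∈ S := by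
    intro w hw
    obtain ⟨y, hy, rfl⟩ := hsurjS w hw
    rw [← mul_smul, initGhost_mul_initElem, hp, hvS y hy]
    exact hy
  have hgkS : ∀ k, ∀ w ∈ S, initGhost K E (ℓ * k) p • w ∈ S := by
    intro k
    induction k with
    | zero => intro w hw; exact (hvS w hw).symm ▸ hw
    | succ k ih =>
      intro w hw
      rw [Nat.mul_succ, Nat.add_comm, initGhost_add, hp, mul_smul]
      exact ih _ (hgS w hw)
  have hrange : ∀ k, ∀ w ∈ S, ∃ y, w = initElem K E (ℓ * k) p • y := by
    intro k
    induction k with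
    | zero => intro w hw; exact ⟨w, (hvS w hw).symm⟩
    | succ k ih =>
      intro w hw
      obtain ⟨y, hy, hwy⟩ := hsurjS w hw
      obtain ⟨z, hz⟩ := ih y hy
      exact ⟨z, by rw [Nat.mul_succ, Nat.add_comm, initElem_add, hp, mul_smul, ← hz, hwy]⟩
  have huw : ∀ i, u i ∈ weightSpace p S p := by
    refine fun i => ⟨fun n => ?_, fun n hn => ?_⟩
    · obtain ⟨y, hy⟩ := hrange n (u i) (huS i)
      have hle : n ≤ ℓ * n := Nat.le_mul_of_pos_left n hℓ
      rw [hy, ← Nat.add_sub_cancel' hle, initElem_add, ← mul_smul]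
      congr 1
      rw [← mul_assoc, mul_assoc (initElem K E n p), initElem_mul_initGhost_mul_initElem]
    · obtain ⟨k, rfl⟩ := hc.length_dvd hn
      exact hgkS k _ (huS i)
  have hsup : (⨆ q : {q : E.InfPath // q.TailEquiv p}, weightSpace p S q.1) = ⊤ := by
    rw [eq_top_iff]
    intro m _
    have hm : m ∈ Submodule.span (LPA K E) (Set.range u) := by rw [htop]; trivial
    induction hm using Submodule.span_induction with
    | mem w hw =>
      obtain ⟨i, rfl⟩ := hw
      exact Submodule.mem_iSup_of_mem ⟨p, 0, 0, rfl⟩ (huw i)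
    | zero => exact Submodule.zero_mem _
    | add x y _ _ hx hy => exact Submodule.add_mem _ (hx trivial) (hy trivial)
    | smul l x _ hx => exact smul_mem_iSup_weightSpace hℓ hp hcS l (hx trivial)
  refine le_antisymm ?_ (Submodule.span_le.2 fun w hw => hw.1)
  refine (le_span_inter_of_iSup_weightSpace_eq_top hℓ hp hsup N).trans (Submodule.span_le.2 ?_)
  rintro w ⟨hwN, hwS⟩
  obtain ⟨j, hj⟩ := exists_span_eq_span_chain (R := LPA K E) (K := K) hu0 hu hwS
  have h1 : u j ∈ N := by
    have : Submodule.span (LPA K E) {u j} ≤ N := by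
      rw [← hj, Submodule.span_singleton_le_iff_mem]; exact hwN
    exact (Submodule.span_singleton_le_iff_mem _ _).1 this
  have h2 : w ∈ Submodule.span (LPA K E) {u j} := by
    rw [← hj]; exact Submodule.mem_span_singleton_self w
  exact Submodule.span_mono (Set.singleton_subset_iff.2
    (show u j ∈ {w | w ∈ N ∧ w ∈ Set.range u} from ⟨h1, j, rfl⟩)) h2

end JordanChain

end DirGraph

/-! ### Chains of submodules of type `ω + 1` and composition series -/

section UniserialChain

/-- A sequence `u` in `M` with `u 0 = 0` and `a u (i + 1) = u i` that generates `M`, that generates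
each submodule of `M` by those of its members that lie in it, and whose members have the
annihilators `R aⁱ`. -/
structure IsUniserialChain (R : Type*) [Ring R] (a : R) {M : Type*} [AddCommGroup M] [Module R M]
    (u : ℕ → M) : Prop where
  zero : u 0 = 0
  smul_succ : ∀ i, a • u (i + 1) = u i
  span_eq_top : Submodule.span R (Set.range u) = ⊤
  eq_span : ∀ N : Submodule R M, N = Submodule.span R {w | w ∈ N ∧ w ∈ Set.range u}
  ann : ∀ i y, y • u i = 0 → y ∈ Submodule.span R {a ^ i}
  one_notMem : (1 : R) ∉ Submodule.span R {a}

namespace IsUniserialChain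

variable {R : Type*} [Ring R] {a : R} {M : Type*} [AddCommGroup M] [Module R M] {u : ℕ → M}

theorem mem_of_le (h : IsUniserialChain R a u) {N : Submodule R M} {i j : ℕ} (hij : i ≤ j)
    (hj : u j ∈ N) : u i ∈ N :=
  DirGraph.chain_mem_of_le h.smul_succ hij hj

theorem pow_smul (h : IsUniserialChain R a u) (n k : ℕ) : a ^ k • u (n + k) = u n := by
  induction k with
  | zero => rw [pow_zero, one_smul, Nat.add_zero]
  | succ k ih => rw [pow_succ, mul_smul, ← Nat.add_assoc, h.smul_succ, ih]

theorem pow_smul_self (h : IsUniserialChain R a u) (n : ℕ) : a ^ n • u n = 0 := by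
  have := h.pow_smul 0 n
  rwa [Nat.zero_add, h.zero] at this

theorem span_mono (h : IsUniserialChain R a u) {i j : ℕ} (hij : i ≤ j) :
    Submodule.span R {u i} ≤ Submodule.span R {u j} := by
  rw [Submodule.span_singleton_le_iff_mem]
  exact h.mem_of_le hij (Submodule.mem_span_singleton_self _)

/-- If `u (i + 1) = y • u i`, then `1 - y a` kills `u (i + 1)`, so it lies in `R aⁱ⁺¹ ⊆ R a`, and
then `1 ∈ R a`. -/
theorem notMem_span (h : IsUniserialChain R a u) (i : ℕ) :
    u (i + 1) ∉ Submodule.span R {u i} := by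
  intro hi
  obtain ⟨y, hy⟩ := Submodule.mem_span_singleton.1 hi
  have h1 : (1 - y * a) • u (i + 1) = 0 := by
    rw [sub_smul, one_smul, mul_smul, h.smul_succ, hy, sub_self]
  obtain ⟨z, hz⟩ := Submodule.mem_span_singleton.1 (h.ann _ _ h1)
  apply h.one_notMem
  rw [Submodule.mem_span_singleton]
  refine ⟨z * a ^ i + y, ?_⟩
  rw [smul_eq_mul, add_mul, mul_assoc, ← pow_succ]
  rw [smul_eq_mul] at hz
  rw [hz, sub_add_cancel]

theorem mem_span_iff (h : IsUniserialChain R a u) {i j : ℕ} :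
    u i ∈ Submodule.span R {u j} ↔ i ≤ j := by
  refine ⟨fun hi => ?_, fun hij => h.mem_of_le hij (Submodule.mem_span_singleton_self _)⟩
  by_contra! hlt
  exact h.notMem_span j (h.mem_of_le hlt hi)

theorem eq_top_or_exists_eq_span (h : IsUniserialChain R a u) (N : Submodule R M) :
    N = ⊤ ∨ ∃ i, N = Submodule.span R {u i} := by
  classical
  by_cases hN : ∀ i, u i ∈ N
  · left
    rw [eq_top_iff, ← h.span_eq_top, Submodule.span_le]
    rintro _ ⟨i, rfl⟩
    exact hN i
  · right
    push Not at hN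
    -- The first index outside `N` is not `0`, because `u 0 = 0`; its predecessor generates `N`.
    obtain ⟨k, hk⟩ : ∃ k, Nat.find hN = k + 1 := by
      refine Nat.exists_eq_succ_of_ne_zero fun h0 => ?_
      have := Nat.find_spec hN
      rw [h0, h.zero] at this
      exact this N.zero_mem
    have h1 : u (k + 1) ∉ N := hk ▸ Nat.find_spec hN
    have h2 : u k ∈ N := not_not.1 (Nat.find_min hN (by omega))
    refine ⟨k, le_antisymm ?_ ((Submodule.span_singleton_le_iff_mem _ _).2 h2)⟩
    rw [h.eq_span N, Submodule.span_le]
    rintro _ ⟨hw, j, rfl⟩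
    refine h.mem_span_iff.2 ?_
    by_contra! hlt
    exact h1 (h.mem_of_le hlt hw)

/-- The members of the lattice of submodules. -/
def submodule (R : Type*) [Ring R] {M : Type*} [AddCommGroup M] [Module R M] (u : ℕ → M) :
    WithTop ℕ → Submodule R M
  | ⊤ => ⊤
  | (i : ℕ) => Submodule.span R {u i}

theorem submodule_strictMono (h : IsUniserialChain R a u) : StrictMono (submodule R u) := by
  intro x y hxy
  cases x with
  | top => exact absurd hxy not_top_lt
  | coe i =>
    cases y with
    | top =>
      refine lt_top_iff_ne_top.2 fun h0 => h.notMem_span i ?_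
      change Submodule.span R {u i} = ⊤ at h0
      rw [h0]
      trivial
    | coe j =>
      rw [WithTop.coe_lt_coe] at hxy
      refine lt_of_le_not_ge (h.span_mono hxy.le) fun hle => ?_
      exact absurd (h.mem_span_iff.1 ((Submodule.span_singleton_le_iff_mem _ _).1 hle)) (by omega)

theorem submodule_surjective (h : IsUniserialChain R a u) :
    Function.Surjective (submodule R u) := by
  intro N
  rcases h.eq_top_or_exists_eq_span N with rfl | ⟨i, rfl⟩
  · exact ⟨⊤, rfl⟩
  · exact ⟨(i : ℕ), rfl⟩

/-- The lattice of submodules is a chain of order type `ω + 1`. -/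
noncomputable def orderIso (h : IsUniserialChain R a u) : WithTop ℕ ≃o Submodule R M :=
  h.submodule_strictMono.orderIsoOfSurjective _ h.submodule_surjective

theorem orderIso_coe (h : IsUniserialChain R a u) (i : ℕ) :
    h.orderIso (i : WithTop ℕ) = Submodule.span R {u i} := rfl

theorem isUniserial (h : IsUniserialChain R a u) : IsUniserial R M := by
  intro N P
  rw [← h.orderIso.symm.le_iff_le, ← h.orderIso.symm.le_iff_le (x := P)]
  exact le_total _ _

theorem isArtinian (h : IsUniserialChain R a u) : IsArtinian R M :=
  h.orderIso.symm.strictMono.wellFoundedLT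

theorem not_isNoetherian (h : IsUniserialChain R a u) : ¬ IsNoetherian R M := by
  intro hn
  obtain ⟨n, hn⟩ := monotone_stabilizes_iff_noetherian.2 hn
    ⟨fun i => Submodule.span R {u i}, fun i j hij => h.span_mono hij⟩
  have h1 : Submodule.span R {u n} = Submodule.span R {u (n + 1)} := hn (n + 1) (Nat.le_succ n)
  apply h.notMem_span n
  rw [h1]
  exact Submodule.mem_span_singleton_self _

theorem span_covBy (h : IsUniserialChain R a u) (i : ℕ) :
    Submodule.span R {u i} ⋖ Submodule.span R {u (i + 1)} := by
  rw [← h.orderIso_coe, ← h.orderIso_coe, apply_covBy_apply_iff]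
  exact WithTop.coe_covBy_coe.2 (Order.covBy_add_one i)

/-- The map `y ↦ y • u 1` identifies `R / R a` with `R u 1`, which is simple because it covers `R u
0 = 0`. -/
theorem isCoatom_span (h : IsUniserialChain R a u) : IsCoatom (Submodule.span R {a}) := by
  refine ⟨fun h0 => h.one_notMem (h0 ▸ trivial), fun J hJ => ?_⟩
  set φ := LinearMap.toSpanSingleton R M (u 1)
  have hker : LinearMap.ker φ ≤ Submodule.span R {a} := by
    intro y hy
    have := h.ann 1 y hy
    rwa [pow_one] at this
  have hle : J.map φ ≤ Submodule.span R {u 1} := by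
    rintro _ ⟨y, -, rfl⟩
    exact Submodule.mem_span_singleton.2 ⟨y, rfl⟩
  have hge : Submodule.span R {u 0} ≤ J.map φ := by
    rw [h.zero, Submodule.span_zero_singleton]
    exact bot_le
  have hcomap : (J.map φ).comap φ = J := by
    rw [Submodule.comap_map_eq]
    exact sup_eq_left.2 (hker.trans hJ.le)
  rcases (h.span_covBy 0).eq_or_eq hge hle with h1 | h1
  · rw [h.zero, Submodule.span_zero_singleton] at h1
    rw [h1] at hcomap
    exact absurd (hcomap.symm.le.trans hker) (not_le_of_gt hJ)
  · rw [h1] at hcomap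
    rw [← hcomap, eq_top_iff]
    intro y _
    exact Submodule.mem_span_singleton.2 ⟨y, rfl⟩

/-- The embedding of `R / R aⁿ` that maps the class of `1` to `u n`. -/
noncomputable def quotPowEmb (h : IsUniserialChain R a u) (n : ℕ) : QuotPow R a n →ₗ[R] M :=
  Submodule.liftQ _ (LinearMap.toSpanSingleton R M (u n))
    ((Submodule.span_singleton_le_iff_mem _ _).2 (h.pow_smul_self n))

theorem quotPowEmb_mk (h : IsUniserialChain R a u) (n : ℕ) (y : R) :
    h.quotPowEmb n (Submodule.Quotient.mk y) = y • u n := rfl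

theorem quotPowEmb_injective (h : IsUniserialChain R a u) (n : ℕ) :
    Function.Injective (h.quotPowEmb n) := by
  rw [← LinearMap.ker_eq_bot]
  exact Submodule.ker_liftQ_eq_bot _ _ _ fun y hy => h.ann n y hy

theorem map_comap_quotPowEmb (h : IsUniserialChain R a u) {i n : ℕ} (hi : i ≤ n) :
    ((Submodule.span R {u i}).comap (h.quotPowEmb n)).map (h.quotPowEmb n)
      = Submodule.span R {u i} := by
  refine Submodule.map_comap_eq_of_le ((h.span_mono hi).trans ?_)
  rw [Submodule.span_singleton_le_iff_mem]
  exact ⟨Submodule.Quotient.mk 1, by rw [quotPowEmb_mk, one_smul]⟩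

theorem isUniserial_quotPow (h : IsUniserialChain R a u) (n : ℕ) :
    IsUniserial R (QuotPow R a n) := by
  intro N P
  rw [← Submodule.map_le_map_iff_of_injective (h.quotPowEmb_injective n),
    ← Submodule.map_le_map_iff_of_injective (h.quotPowEmb_injective n) P]
  exact h.isUniserial _ _

/-- The composition series of `R / R aⁿ`. -/
noncomputable def series (h : IsUniserialChain R a u) (n : ℕ) :
    CompositionSeries (Submodule R (QuotPow R a n)) where
  length := n
  toFun i := (Submodule.span R {u i}).comap (h.quotPowEmb n)
  step i := by
    refine CovBy.of_image (OrderEmbedding.ofMapLEIff (Submodule.map (h.quotPowEmb n))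
      fun _ _ => Submodule.map_le_map_iff_of_injective (h.quotPowEmb_injective n) _ _) ?_
    simp only [OrderEmbedding.coe_ofMapLEIff]
    rw [h.map_comap_quotPowEmb (by simp), h.map_comap_quotPowEmb (by simp)]
    simpa using h.span_covBy i

theorem series_head (h : IsUniserialChain R a u) (n : ℕ) : (h.series n).head = ⊥ := by
  change (Submodule.span R {u 0}).comap (h.quotPowEmb n) = ⊥
  rw [h.zero, Submodule.span_zero_singleton, ← LinearMap.ker, LinearMap.ker_eq_bot]
  exact h.quotPowEmb_injective n

theorem series_last (h : IsUniserialChain R a u) (n : ℕ) : (h.series n).last = ⊤ := by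
  change (Submodule.span R {u n}).comap (h.quotPowEmb n) = ⊤
  rw [eq_top_iff]
  intro x _
  obtain ⟨y, rfl⟩ := Submodule.Quotient.mk_surjective _ x
  exact Submodule.mem_span_singleton.2 ⟨y, rfl⟩

end IsUniserialChain

/-- A composition series in a totally ordered lattice contains all elements between its ends. -/
theorem CompositionSeries.mem_of_total {X : Type*} [Lattice X] [IsModularLattice X]
    (ht : ∀ x y : X, x ≤ y ∨ y ≤ x) (s : CompositionSeries X) {x : X} (hx : s.head ≤ x)
    (hx' : x ≤ s.last) : x ∈ s := by
  have key : ∀ i : Fin (s.length + 1), x ≤ s i → x ∈ s := by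
    intro i
    induction i using Fin.induction with
    | zero => intro h; exact ⟨0, le_antisymm hx h⟩
    | succ i ih =>
      intro h
      rcases ht x (s i.castSucc) with h1 | h1
      · exact ih h1
      · rcases CovBy.eq_or_eq (s.step i) h1 h with h2 | h2
        · exact ⟨_, h2.symm⟩
        · exact ⟨_, h2.symm⟩
  exact key _ hx'

/-- Both series contain every element of the lattice, and a composition series is determined by its
members. -/
theorem CompositionSeries.eq_of_total {X : Type*} [Lattice X] [IsModularLattice X]
    [BoundedOrder X] (ht : ∀ x y : X, x ≤ y ∨ y ≤ x) (s t : CompositionSeries X)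
    (hs : s.head = ⊥) (hs' : s.last = ⊤) (h : t.head = ⊥) (h' : t.last = ⊤) : t = s :=
  CompositionSeries.ext fun _ => ⟨fun _ => s.mem_of_total ht (hs ▸ bot_le) (hs' ▸ le_top),
    fun _ => t.mem_of_total ht (h ▸ bot_le) (h' ▸ le_top)⟩

/-- A nonzero cyclic module whose generator is killed by `a` is isomorphic to `R / R a` if the left
ideal `R a` is maximal. -/
theorem nonempty_quot_equiv {R : Type*} [Ring R] {a : R} (ha : IsCoatom (Submodule.span R {a}))
    {Q : Type*} [AddCommGroup Q] [Module R Q] {q : Q} (hq : a • q = 0) (hq0 : q ≠ 0)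
    (hspan : ∀ x : Q, ∃ y : R, y • q = x) :
    Nonempty ((R ⧸ (Submodule.span R {a} : Submodule R R)) ≃ₗ[R] Q) := by
  have hker : LinearMap.ker (LinearMap.toSpanSingleton R Q q) = Submodule.span R {a} := by
    refine (ha.le_iff.1 ((Submodule.span_singleton_le_iff_mem _ _).2 hq)).resolve_left fun h => ?_
    have h1 : (1 : R) ∈ LinearMap.ker (LinearMap.toSpanSingleton R Q q) := h ▸ trivial
    rw [LinearMap.mem_ker, LinearMap.toSpanSingleton_apply, one_smul] at h1
    exact hq0 h1
  exact ⟨(Submodule.quotEquivOfEq _ _ hker.symm).trans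
    (LinearMap.quotKerEquivOfSurjective _ hspan)⟩

theorem IsUniserialChain.nonempty_factor_equiv {R : Type*} [Ring R] {a : R} {M : Type*}
    [AddCommGroup M] [Module R M] {u : ℕ → M} (h : IsUniserialChain R a u) (n : ℕ)
    (i : Fin (h.series n).length) :
    Nonempty ((R ⧸ (Submodule.span R {a} : Submodule R R)) ≃ₗ[R]
      ((h.series n) i.succ ⧸ ((h.series n) i.castSucc).submoduleOf ((h.series n) i.succ))) := by
  have hi : (i : ℕ) < n := i.2
  have hmem : ∀ x : QuotPow R a n, ∀ j : Fin ((h.series n).length + 1),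
      x ∈ (h.series n) j ↔ h.quotPowEmb n x ∈ Submodule.span R {u j} := fun _ _ => Iff.rfl
  -- The embedding sends the class of `a ^ (n - (i + 1))` to `u (i + 1)`, so it generates the upper
  -- term, while `a • x` falls into the lower one.
  set x : QuotPow R a n := Submodule.Quotient.mk (a ^ (n - (i + 1)))
  have hx : h.quotPowEmb n x = u (i + 1) := by
    have := h.pow_smul (i + 1) (n - (i + 1))
    rwa [Nat.add_sub_cancel' hi] at this
  have hxs : x ∈ (h.series n) i.succ := by
    rw [hmem, hx]; exact Submodule.mem_span_singleton_self _
  refine nonempty_quot_equiv h.isCoatom_span (q := Submodule.Quotient.mk ⟨x, hxs⟩) ?_ ?_ ?_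
  · rw [← Submodule.Quotient.mk_smul, Submodule.Quotient.mk_eq_zero]
    change a • x ∈ (h.series n) i.castSucc
    rw [hmem, map_smul, hx, h.smul_succ]
    exact Submodule.mem_span_singleton_self _
  · rw [Ne, Submodule.Quotient.mk_eq_zero]
    change x ∉ (h.series n) i.castSucc
    rw [hmem, hx]
    exact h.notMem_span i
  · intro z
    obtain ⟨⟨z, hz⟩, rfl⟩ := Submodule.Quotient.mk_surjective _ z
    have hz' := hz
    rw [hmem] at hz'
    obtain ⟨y, hy⟩ := Submodule.mem_span_singleton.1 hz'
    refine ⟨y, ?_⟩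
    rw [← Submodule.Quotient.mk_smul]
    congr 1
    refine Subtype.ext (h.quotPowEmb_injective n ?_)
    change h.quotPowEmb n (y • x) = _
    rw [map_smul, hx]
    exact hy

end UniserialChain

/-! ### The Jordan chain of the Prüfer module -/

section Prufer

variable (R : Type*) [Ring R] (a : R)

theorem quotPowMap_mk (i j : ℕ+) (h : i ≤ j) (y : R) :
    quotPowMap R a i j h (Submodule.Quotient.mk y) = Submodule.Quotient.mk (y * a ^ ((j : ℕ) - i)) :=
  rfl

instance : DirectedSystem (fun i : ℕ+ => QuotPow R a i)
    (fun i j (h : i ≤ j) => quotPowMap R a i j h) where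
  map_self i x := by
    obtain ⟨y, rfl⟩ := Submodule.Quotient.mk_surjective _ x
    rw [quotPowMap_mk, Nat.sub_self, pow_zero, mul_one]
  map_map k j i hij hjk x := by
    obtain ⟨y, rfl⟩ := Submodule.Quotient.mk_surjective _ x
    rw [quotPowMap_mk, quotPowMap_mk, quotPowMap_mk, mul_assoc, ← pow_add]
    have h1 : (i : ℕ) ≤ j := hij
    have h2 : (j : ℕ) ≤ k := hjk
    rw [show (j : ℕ) - i + (k - j) = k - i by omega]

/-- The images of the classes of `1` in the Prüfer module. -/
noncomputable def pruferGen : ℕ → PruferModule R a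
  | 0 => 0
  | i + 1 => Module.DirectLimit.of R ℕ+ (fun i : ℕ+ => QuotPow R a i)
      (fun i j (h : i ≤ j) => quotPowMap R a i j h) i.succPNat (Submodule.Quotient.mk 1)

theorem of_mk_eq_smul_pruferGen (i : ℕ) (y : R) :
    Module.DirectLimit.of R ℕ+ (fun i : ℕ+ => QuotPow R a i)
      (fun i j (h : i ≤ j) => quotPowMap R a i j h) i.succPNat (Submodule.Quotient.mk y)
      = y • pruferGen R a (i + 1) := by
  rw [pruferGen, ← map_smul, ← Submodule.Quotient.mk_smul, smul_eq_mul, mul_one]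

theorem smul_pruferGen_succ (i : ℕ) : a • pruferGen R a (i + 1) = pruferGen R a i := by
  rw [← of_mk_eq_smul_pruferGen]
  cases i with
  | zero =>
    have : (Submodule.Quotient.mk a : QuotPow R a (Nat.succPNat 0)) = 0 := by
      rw [Submodule.Quotient.mk_eq_zero]
      simp
    rw [this, map_zero, pruferGen]
  | succ i =>
    rw [pruferGen, ← Module.DirectLimit.of_f (hij := show i.succPNat ≤ (i + 1).succPNat from
      Nat.succ_le_succ (Nat.le_succ i)), quotPowMap_mk]
    congr 2
    simp

theorem span_range_pruferGen : Submodule.span R (Set.range (pruferGen R a)) = ⊤ := by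
  rw [eq_top_iff]
  intro z _
  obtain ⟨i, x, rfl⟩ := Module.DirectLimit.exists_of z
  obtain ⟨y, rfl⟩ := Submodule.Quotient.mk_surjective _ x
  obtain ⟨i, rfl⟩ : ∃ k : ℕ, i = k.succPNat := ⟨i.natPred, (PNat.succPNat_natPred i).symm⟩
  rw [of_mk_eq_smul_pruferGen]
  exact Submodule.smul_mem _ _ (Submodule.subset_span ⟨_, rfl⟩)

/-- Vanishing in the limit means `y a ^ (j - i) = z a ^ j` for some later stage `j`; right
cancellation of `a ^ (j - i)` leaves `y = z a ^ i`. -/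
theorem mem_span_pow_of_smul_pruferGen_eq_zero
    (ha : ∀ (n : ℕ) (x : R), x * a ^ n = 0 → x = 0) (i : ℕ) (y : R)
    (h : y • pruferGen R a i = 0) : y ∈ Submodule.span R {a ^ i} := by
  cases i with
  | zero => exact Submodule.mem_span_singleton.2 ⟨y, by simp⟩
  | succ i =>
    rw [← of_mk_eq_smul_pruferGen] at h
    obtain ⟨j, hij, hj⟩ := Module.DirectLimit.of.zero_exact h
    rw [quotPowMap_mk, Submodule.Quotient.mk_eq_zero, Submodule.mem_span_singleton] at hj
    obtain ⟨z, hz⟩ := hj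
    have hle : i + 1 ≤ (j : ℕ) := hij
    refine Submodule.mem_span_singleton.2 ⟨z, ?_⟩
    rw [smul_eq_mul] at hz ⊢
    rw [← sub_eq_zero]
    refine ha ((j : ℕ) - (i + 1)) _ ?_
    rw [sub_mul, mul_assoc, ← pow_add, Nat.add_sub_cancel' hle, hz]
    exact sub_self _

end Prufer

namespace DirGraph

/-! ### The Chen module as the quotient by `c - 1` -/

section ChenModule

variable {V A : Type*} (K : Type*) [Field K] (E : DirGraph V A)
  (p : E.InfPath)

/-- The basis vectors of the Chen module. -/
noncomputable def chenBasis (q : {q : E.InfPath // q.TailEquiv p}) : Chen K E p :=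
  Finsupp.single q (1 : K)

theorem chenBasis_ne_zero (q : {q : E.InfPath // q.TailEquiv p}) : chenBasis K E p q ≠ 0 := by
  intro h
  exact one_ne_zero (α := K) (Finsupp.single_eq_zero.1 h)

variable [Fintype V] [Fintype A]

theorem gen_smul_chenBasis (x : LGen V A) (q : {q : E.InfPath // q.TailEquiv p}) :
    gen K E x • chenBasis K E p q = chenBasisAct K E p x q := by
  rw [← chenGenAct_single]
  have h : chenRep K E p (gen K E x) = chenGenAct K E p x := by
    refine (RingQuot.liftAlgHom_mkAlgHom_apply K _ (chenGenAct_rel K E p) _).trans ?_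
    rw [FreeAlgebra.lift_ι_apply]
  exact congrArg (fun f : Module.End K _ => f (Finsupp.single q (1 : K))) h

theorem algebraMap_smul_chen (k : K) (x : Chen K E p) :
    algebraMap K (LPA K E) k • x = k • x :=
  congrArg (fun f : Module.End K ({q : E.InfPath // q.TailEquiv p} →₀ K) => f x)
    ((chenRep K E p).commutes k)

theorem initElem_smul_chenBasis (n : ℕ) (q : E.InfPath) (h : (q.drop n).TailEquiv p)
    (h' : q.TailEquiv p) :
    initElem K E n q • chenBasis K E p ⟨q.drop n, h⟩ = chenBasis K E p ⟨q, h'⟩ := by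
  induction n generalizing q with
  | zero =>
    rw [initElem, gen_smul_chenBasis]
    simp only [chenBasisAct, InfPath.drop_zero, if_true]
    rfl
  | succ n ih =>
    have hd : q.drop (n + 1) = (q.drop 1).drop n := by rw [InfPath.drop_drop, Nat.add_comm]
    have h1 : (⟨q.drop (n + 1), h⟩ : {q : E.InfPath // q.TailEquiv p})
        = ⟨(q.drop 1).drop n, hd ▸ h⟩ := Subtype.ext hd
    rw [initElem, mul_smul, h1, ih (q.drop 1) _ h'.drop_one, gen_smul_chenBasis]
    simp only [chenBasisAct]
    rw [dif_pos (InfPath.source_drop_one q).symm]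
    simp only [InfPath.cons_drop_one]
    rfl

variable {E} {c : List A} (hc : E.IsClosedPath c)

/-- Every path tail equivalent to `c^∞` is a finite path followed by `c^∞` itself, because `c^∞` is
periodic. -/
theorem exists_smul_chenBasis_eq (x : Chen K E hc.infPow) :
    ∃ l : LPA K E, l • chenBasis K E hc.infPow ⟨hc.infPow, 0, 0, rfl⟩ = x := by
  induction x using Finsupp.induction_linear with
  | zero => exact ⟨0, zero_smul _ _⟩
  | add x y hx hy =>
    obtain ⟨l, rfl⟩ := hx
    obtain ⟨m, rfl⟩ := hy
    exact ⟨l + m, add_smul _ _ _⟩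
  | single q k =>
    obtain ⟨n, hn⟩ := q.2.exists_drop_eq hc.length_pos hc.infPow_drop_length
    have h := initElem_smul_chenBasis K E hc.infPow n q.1 ⟨0, 0, by rw [hn]⟩ q.2
    simp only [hn] at h
    refine ⟨algebraMap K _ k * initElem K E n q.1, ?_⟩
    rw [mul_smul, h, algebraMap_smul_chen]
    exact (Finsupp.smul_single_one q k)

theorem sub_one_smul_chenBasis :
    (pathElem K E c - 1) • chenBasis K E hc.infPow ⟨hc.infPow, 0, 0, rfl⟩ = 0 := by
  have h := initElem_smul_chenBasis K E hc.infPow c.length hc.infPow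
    ⟨0, 0, by rw [hc.infPow_drop_length]⟩ ⟨0, 0, rfl⟩
  simp only [hc.infPow_drop_length] at h
  rw [pathElem_eq_initElem K hc, sub_smul, one_smul, h, sub_self]

theorem isUniserialChain_pruferGen (hb : E.IsBasicClosedPath c) :
    IsUniserialChain (LPA K E) (pathElem K E c - 1)
      (pruferGen (LPA K E) (pathElem K E c - 1)) where
  zero := rfl
  smul_succ := smul_pruferGen_succ _ _
  span_eq_top := span_range_pruferGen _ _
  eq_span N := eq_span_chain_mem (M := PruferModule (LPA K E) (pathElem K E c - 1))
    (u := pruferGen (LPA K E) (pathElem K E c - 1)) hb rfl (smul_pruferGen_succ _ _)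
    (span_range_pruferGen _ _) N
  ann := mem_span_pow_of_smul_pruferGen_eq_zero _ _ fun n _ h =>
    eq_zero_of_mul_pathElem_sub_one_pow K E hb.1.1 n h
  one_notMem h := by
    -- The Chen module certifies `R a ≠ R`: if `y a = 1`, then `c^∞ = y a c^∞ = 0`.
    obtain ⟨y, hy⟩ := Submodule.mem_span_singleton.1 h
    apply chenBasis_ne_zero K E hb.1.infPow ⟨hb.1.infPow, 0, 0, rfl⟩
    rw [← one_smul (LPA K E) (chenBasis _ _ _ _), ← hy, smul_eq_mul, mul_smul,
      sub_one_smul_chenBasis, smul_zero]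

end ChenModule

end DirGraph

theorem mainTheorem2 {V A : Type*} [Fintype V] [Fintype A] (K : Type*) [Field K]
    (E : DirGraph V A) (c : List A) (hc : E.IsBasicClosedPath c) :
    (∀ n : ℕ,
      IsUniserial (DirGraph.LPA K E)
        (QuotPow (DirGraph.LPA K E) (DirGraph.pathElem K E c - 1) n) ∧
      ∃ σ : CompositionSeries (Submodule (DirGraph.LPA K E)
          (QuotPow (DirGraph.LPA K E) (DirGraph.pathElem K E c - 1) n)),
        (σ.head = ⊥ ∧ σ.last = ⊤) ∧
        (∀ τ : CompositionSeries (Submodule (DirGraph.LPA K E)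
            (QuotPow (DirGraph.LPA K E) (DirGraph.pathElem K E c - 1) n)),
          τ.head = ⊥ → τ.last = ⊤ → τ = σ) ∧
        ∀ i : Fin σ.length,
          Nonempty ((σ i.succ ⧸ (σ i.castSucc).submoduleOf (σ i.succ)) ≃ₗ[DirGraph.LPA K E]
            DirGraph.Chen K E hc.1.infPow)) ∧
    IsUniserial (DirGraph.LPA K E)
      (PruferModule (DirGraph.LPA K E) (DirGraph.pathElem K E c - 1)) ∧
    IsArtinian (DirGraph.LPA K E)
      (PruferModule (DirGraph.LPA K E) (DirGraph.pathElem K E c - 1)) ∧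
    ¬ IsNoetherian (DirGraph.LPA K E)
      (PruferModule (DirGraph.LPA K E) (DirGraph.pathElem K E c - 1)) := by

  have h := DirGraph.isUniserialChain_pruferGen K hc
  refine ⟨fun n => ⟨h.isUniserial_quotPow n, h.series n, ⟨h.series_head n, h.series_last n⟩,
    fun τ hτ hτ' => CompositionSeries.eq_of_total (h.isUniserial_quotPow n) _ _ (h.series_head n)
      (h.series_last n) hτ hτ', fun i => ?_⟩, h.isUniserial, h.isArtinian, h.not_isNoetherian⟩
  -- The factor and the Chen module are compared through `R / R a`.
  obtain ⟨e⟩ := h.nonempty_factor_equiv n i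
  obtain ⟨f⟩ := nonempty_quot_equiv h.isCoatom_span
    (DirGraph.sub_one_smul_chenBasis K hc.1) (DirGraph.chenBasis_ne_zero K E _ _)
    (DirGraph.exists_smul_chenBasis_eq K hc.1)
  exact ⟨e.symm.trans f⟩
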